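/- Let $N$ be a smooth (Hausdorff, second countable) manifold with or without boundary, and let $\Theta:\mathbb{R}\times N\to N$ be a smooth $\mathbb{R}$-action that is proper, i.e. the shear map $\mathbb{R}\times N\to N\times N$, $(s,p)\mapsto (p,\Theta(s,p))$, is a proper map. Let $\pi:N\to N/\mathbb{R}$ be the quotient map onto the orbit space, where $N/\mathbb{R}$ carries its quotient smooth structure (the unique one for which $\pi$ is smooth and has smooth local sections, so that $\pi$ is a smooth principal $\mathbb{R}$-bundle). Let $X_p=\frac{\mathrm{d}}{\mathrm{d}s}\big|_{s=0}\Theta(s,p)$ be the fundamental vector field. For a compactly supported smooth form $\alpha\in\Omega^{k+1}_{\mathrm c}(N)$, $k\ge 0$, define $$G^\uparrow_\Theta\alpha:=\int_{\mathbb{R}^{\le 0}}\Theta^*\alpha,\qquad G^\downarrow_\Theta\alpha:=-\int_{\mathbb{R}^{\ge 0}}\Theta^*\alpha,$$ where, for a $(k+1)$-form $\beta$ on $\mathbb{R}\times N$ and $A\subseteq\mathbb{R}$, the fiber integral over $A\times N\to N$ is $$\Big(\int_A\beta\Big)_p(v_1,\dots,v_k)=\int_A\beta_{(s,p)}(\partial_s,v_1,\dots,v_k)\,\mathrm{d}s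 .$$ Let $\pi_*\alpha$ be the fiber integral of $\alpha$ along $\pi$, $$(\pi_*\alpha)_b(v_1,\dots,v_k)=\int_{\mathbb{R}}\alpha_{\Theta(s,p)}\big(X,\tilde v_1(s),\dots,\tilde v_k(s)\big)\,\mathrm{d}s,$$ where $p$ is any point of the orbit $\pi^{-1}(b)$ and $\tilde v_i(s)\in T_{\Theta(s,p)}N$ is any lift of $v_i\in T_b(N/\mathbb{R})$ along $\mathrm{d}\pi$. Then all these integrals converge, they define linear maps $$G^\uparrow_\Theta,\ G^\downarrow_\Theta:\Omega^{k+1}_{\mathrm c}(N)\to\Omega^{k}(N),\qquad \pi_*:\Omega^{k+1}_{\mathrm c}(N)\to\Omega^{k}(N/\mathbb{R})$$ into smooth forms for every $k\ge 0$, the pullback $\pi^*$ is a linear map $\Omega^k(N/\mathbb{R})\to\Omega^k(N)$, and $$G^\uparrow_\Theta-G^\downarrow_\Theta=\pi^*\,\pi_*:\Omega^{k+1}_{\mathrm c}(N)\longrightarrow\Omega^{k}(N).$$ -/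

import Mathlib

open Set MeasureTheory Topology
open scoped Manifold ContDiff

noncomputable section

section Forms

variable {E H M : Type*} [NormedAddCommGroup E] [NormedSpace ℝ E] [TopologicalSpace H]
  (I : ModelWithCorners ℝ E H) [TopologicalSpace M] [ChartedSpace H M]

/-- The differential at `y` of the inverse of the preferred chart of the manifold `M` at `x₀`, from
`E` to the tangent space of `M` (which Mathlib defines to be the model vector space `E`). -/
def chartInvDeriv (x₀ : M) (y : E) : E →L[ℝ] E :=
  mfderiv[range I] (extChartAt I x₀).symm y

/-- The representation of a `k`-form `η` on `M` in the preferred chart at `x₀`: the pullback of `η`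
along the inverse of that chart. A `k`-form is a function `η : M → E [⋀^Fin k]→L[ℝ] ℝ`, where `η p`
is an alternating form on `TangentSpace I p = E`. -/
def formInChart {k : ℕ} (η : M → E [⋀^Fin k]→L[ℝ] ℝ) (x₀ : M) : E → E [⋀^Fin k]→L[ℝ] ℝ :=
  fun y => (η ((extChartAt I x₀).symm y)).compContinuousLinearMap (chartInvDeriv I x₀ y)

/-- The space `Ω^k(M)` of smooth `k`-forms: the pullback along the inverse of every chart is
smooth. -/
def smoothForms (M : Type*) [TopologicalSpace M] [ChartedSpace H M] (k : ℕ) :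
    Submodule ℝ (M → E [⋀^Fin k]→L[ℝ] ℝ) where
  carrier := {η | ∀ x₀ : M, ContDiffOn ℝ ∞ (formInChart I η x₀) (extChartAt I x₀).target}
  zero_mem' := fun x₀ => by
    have h : formInChart I (0 : M → E [⋀^Fin k]→L[ℝ] ℝ) x₀ = fun _ => 0 := by
      funext y; ext v; simp [formInChart]
    rw [h]; exact contDiffOn_const
  add_mem' := fun {a b} ha hb x₀ => by
    have h : formInChart I (a + b) x₀ = fun y => formInChart I a x₀ y + formInChart I b x₀ y := by
      funext y; ext v; simp [formInChart]
    rw [h]; exact (ha x₀).add (hb x₀)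
  smul_mem' := fun c a ha x₀ => by
    have h : formInChart I (c • a) x₀ = fun y => c • formInChart I a x₀ y := by
      funext y; ext v; simp [formInChart]
    rw [h]; exact (ha x₀).const_smul c

/-- The space `Ω_c^k(M)` of compactly supported smooth `k`-forms. -/
def compactForms (M : Type*) [TopologicalSpace M] [ChartedSpace H M] (k : ℕ) :
    Submodule ℝ (M → E [⋀^Fin k]→L[ℝ] ℝ) where
  carrier := {η | η ∈ smoothForms I M k ∧ HasCompactSupport η}
  zero_mem' := ⟨(smoothForms I M k).zero_mem, HasCompactSupport.zero⟩
  add_mem' := fun ha hb => ⟨(smoothForms I M k).add_mem ha.1 hb.1, ha.2.add hb.2⟩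
  smul_mem' := fun c a ha => ⟨(smoothForms I M k).smul_mem c ha.1,
    ha.2.mono' (fun x hx => subset_tsupport a (fun h0 => hx (by simp [h0])))⟩

variable {E' H' M' : Type*} [NormedAddCommGroup E'] [NormedSpace ℝ E'] [TopologicalSpace H']
  (I' : ModelWithCorners ℝ E' H') [TopologicalSpace M'] [ChartedSpace H' M']

/-- The differential of a map of manifolds at `p`, as a map of the model vector spaces. -/
def modelDeriv (f : M → M') (p : M) : E →L[ℝ] E' := mfderiv I I' f p

/-- Pullback `f^* η` of a form along a map of manifolds. -/
def formPullback {k : ℕ} (f : M → M') (η : M' → E' [⋀^Fin k]→L[ℝ] ℝ) :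
    M → E [⋀^Fin k]→L[ℝ] ℝ :=
  fun p => (η (f p)).compContinuousLinearMap (modelDeriv I I' f p)

end Forms

section Projection

variable {E M : Type*} [NormedAddCommGroup E] [NormedSpace ℝ E]

/-- For a `(k+1)`-form `β` on `ℝ × M`, the form `v ↦ β_(s,p)(∂_s, v₁, …, v_k)` on the tangent
space of `M` at `p`. -/
def prIntegrand {k : ℕ} (β : ℝ × M → (ℝ × E) [⋀^Fin (k + 1)]→L[ℝ] ℝ) (p : M) (s : ℝ) :
    E [⋀^Fin k]→L[ℝ] ℝ :=
  ((β (s, p)).curryLeft (1, 0)).compContinuousLinearMap (ContinuousLinearMap.inr ℝ ℝ E)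

/-- Integration of a `(k+1)`-form on `ℝ × M` over the fibers of `pr : A × M → M`, for `A ⊆ ℝ` with
its standard orientation, in the fiber-first convention
(`f ds ∧ φ ↦ (∫_A f ds) φ` for `φ` without `ds`-leg). -/
def prIntegral {k : ℕ} (A : Set ℝ) (β : ℝ × M → (ℝ × E) [⋀^Fin (k + 1)]→L[ℝ] ℝ) :
    M → E [⋀^Fin k]→L[ℝ] ℝ :=
  fun p => ∫ s in A, prIntegrand β p s

end Projection

section Action

variable {E H N : Type*} [NormedAddCommGroup E] [NormedSpace ℝ E] [TopologicalSpace H]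
  (I : ModelWithCorners ℝ E H) [TopologicalSpace N] [ChartedSpace H N] [AddAction ℝ N]

/-- The action map `Θ : ℝ × N → N`. -/
def flowMap (N : Type*) [AddAction ℝ N] : ℝ × N → N := fun x => x.1 +ᵥ x.2

/-- `Θ^* α` for a form `α` on `N`. -/
def flowPullback {k : ℕ} (α : N → E [⋀^Fin k]→L[ℝ] ℝ) : ℝ × N → (ℝ × E) [⋀^Fin k]→L[ℝ] ℝ :=
  formPullback (𝓘(ℝ, ℝ).prod I) I (flowMap N) α

/-- `G^↑_Θ α = ∫_{ℝ^{≤ 0}} Θ^* α`. -/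
def greenForward {k : ℕ} (α : N → E [⋀^Fin (k + 1)]→L[ℝ] ℝ) : N → E [⋀^Fin k]→L[ℝ] ℝ :=
  prIntegral (Iic 0) (flowPullback I α)

/-- `G^↓_Θ α = - ∫_{ℝ^{≥ 0}} Θ^* α`. -/
def greenBackward {k : ℕ} (α : N → E [⋀^Fin (k + 1)]→L[ℝ] ℝ) : N → E [⋀^Fin k]→L[ℝ] ℝ :=
  -prIntegral (Ici 0) (flowPullback I α)

/-- The fundamental vector field `X_p = d/ds|_{s = 0} Θ(s, p)` of the action. -/
def flowField (p : N) : E := modelDeriv 𝓘(ℝ, ℝ) I (fun s : ℝ => s +ᵥ p) 0 1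

/-- The quotient map `π : N → N/ℝ` to the orbit space (with the quotient topology). -/
def orbitMap (N : Type*) [AddAction ℝ N] : N → AddAction.orbitRel.Quotient ℝ N :=
  Quotient.mk _

variable {E' H' : Type*} [NormedAddCommGroup E'] [NormedSpace ℝ E'] [TopologicalSpace H']
  (I' : ModelWithCorners ℝ E' H') [ChartedSpace H' (AddAction.orbitRel.Quotient ℝ N)]

/-- The given smooth structure on the orbit space `N/ℝ` is the quotient smooth structure:
the quotient map `π : N → N/ℝ` is smooth and has smooth local sections. There is at most one such
structure, since a function on `N/ℝ` is then smooth if and only if its composition with `π` is. -/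
structure IsQuotientManifold : Prop where
  contMDiff_orbitMap : ContMDiff I I' ∞ (orbitMap N)
  exists_local_section : ∀ b : AddAction.orbitRel.Quotient ℝ N, ∃ U ∈ 𝓝 b,
    ∃ σ : AddAction.orbitRel.Quotient ℝ N → N,
      ContMDiffOn I' I ∞ σ U ∧ ∀ c ∈ U, orbitMap N (σ c) = c

/-- A linear choice `T_{π(q)}(N/ℝ) → T_q N` of lifts of tangent vectors along `dπ_q`. -/
def tangentLift (q : N) : E' →L[ℝ] E :=
  Classical.epsilon fun R : E' →L[ℝ] E => ∀ v : E', modelDeriv I I' (orbitMap N) q (R v) = v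

/-- For a `(k+1)`-form `α` on `N` and `q` in the fiber over `b = π(q)`, the form
`(v₁, …, v_k) ↦ α_q(X_q, ṽ₁, …, ṽ_k)` on `T_b(N/ℝ)`, where `ṽᵢ ∈ T_q N` lifts `vᵢ`. As `X_q` spans
the kernel of `dπ_q`, it does not depend on the lifts. -/
def orbitIntegrand {k : ℕ} (α : N → E [⋀^Fin (k + 1)]→L[ℝ] ℝ) (q : N) :
    E' [⋀^Fin k]→L[ℝ] ℝ :=
  ((α q).curryLeft (flowField I q)).compContinuousLinearMap (tangentLift I I' q)

/-- Fiber integration `π_*` along the quotient map, in the fiber-first convention. The fiber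
over `b` is the orbit of any point `p` over `b`. It is parametrized by `s ↦ Θ(s, p)`, with velocity
`X`, and oriented by `X`. -/
def fiberIntegral {k : ℕ} (α : N → E [⋀^Fin (k + 1)]→L[ℝ] ℝ) :
    AddAction.orbitRel.Quotient ℝ N → E' [⋀^Fin k]→L[ℝ] ℝ :=
  fun b => ∫ s : ℝ, orbitIntegrand I I' α (s +ᵥ b.out)

end Action

end

/-!
Writing `Θ^*α = dt ∧ β_t + γ_t`, the two half-line integrals add up to the integral over all of
`ℝ` of `β_t = Θ_t^*(ι_X α)`. Since `dπ ∘ dΘ_t = dπ`, each lift of `dπ(v)` to `Θ(t, p)` differs from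
`dΘ_t(v)` by an element of `ker dπ`, which is spanned by `X`, and `ι_X α` does not see multiples of
`X`. So the same integral computes `π^*π_*α`.

Properness confines the relevant times to a compact set, locally uniformly in `p`, whence
convergence and smoothness by differentiation under the integral. It also excludes fixed
times `t ≠ 0`, so `X` vanishes nowhere. Smoothness of `π_*α` follows from that of `π^*π_*α`, because
`π` has smooth local sections.
-/

noncomputable section

section AlternatingPullback

variable {𝕜 ι E E' F G : Type*} [NontriviallyNormedField 𝕜] [Fintype ι]
  [NormedAddCommGroup E] [NormedSpace 𝕜 E] [NormedAddCommGroup E'] [NormedSpace 𝕜 E']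
  [NormedAddCommGroup F] [NormedSpace 𝕜 F] [NormedAddCommGroup G] [NormedSpace 𝕜 G]

lemma norm_alternatization_le [DecidableEq ι] (f : ContinuousMultilinearMap 𝕜 (fun _ : ι => E) F) :
    ‖ContinuousMultilinearMap.alternatization f‖ ≤ (Fintype.card ι).factorial * ‖f‖ := by
  refine ContinuousAlternatingMap.opNorm_le_bound _ (by positivity) fun v => ?_
  have hσ (σ : Equiv.Perm ι) : ‖Equiv.Perm.sign σ • f (v ∘ σ)‖ ≤ ‖f‖ * ∏ i, ‖v i‖ :=
    calc ‖Equiv.Perm.sign σ • f (v ∘ σ)‖ = ‖f (v ∘ σ)‖ := by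
          rcases Int.units_eq_one_or (Equiv.Perm.sign σ) with h | h <;> simp [h]
      _ ≤ ‖f‖ * ∏ i, ‖v (σ i)‖ := f.le_opNorm _
      _ = ‖f‖ * ∏ i, ‖v i‖ := by rw [Equiv.prod_comp σ fun i => ‖v i‖]
  rw [ContinuousMultilinearMap.alternatization_apply_apply]
  refine (norm_sum_le_of_le _ fun σ _ => hσ σ).trans_eq ?_
  rw [Finset.sum_const, Finset.card_univ, Fintype.card_perm, nsmul_eq_mul, mul_assoc]

variable (𝕜 ι E F) in
/-- The alternatization `f ↦ ∑ σ, sign σ • f ∘ σ` as a continuous linear map. -/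
def alternatizationCLM [DecidableEq ι] :
    ContinuousMultilinearMap 𝕜 (fun _ : ι => E) F →L[𝕜] E [⋀^ι]→L[𝕜] F :=
  LinearMap.mkContinuous
    { toFun := ContinuousMultilinearMap.alternatization
      map_add' := map_add _
      map_smul' := fun c f => by
        ext v
        simp [ContinuousMultilinearMap.alternatization_apply_apply, Finset.smul_sum, smul_comm c] }
    (Fintype.card ι).factorial norm_alternatization_le

lemma alternatizationCLM_toContinuousMultilinearMap [DecidableEq ι] (f : E [⋀^ι]→L[𝕜] F) :
    alternatizationCLM 𝕜 ι E F f.toContinuousMultilinearMap = (Fintype.card ι).factorial • f :=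
  ContinuousAlternatingMap.toAlternatingMap_injective <|
    (ContinuousMultilinearMap.alternatization_apply_toAlternatingMap _).trans
      f.toAlternatingMap.coe_alternatization

lemma contDiffWithinAt_alternatingMap_compContinuousLinearMap [CharZero 𝕜] {n : ℕ∞ω} {s : Set G}
    {x : G} {f : G → E' [⋀^ι]→L[𝕜] F} {L : G → E →L[𝕜] E'} (hf : ContDiffWithinAt 𝕜 n f s x)
    (hL : ContDiffWithinAt 𝕜 n L s x) :
    ContDiffWithinAt 𝕜 n (fun y => (f y).compContinuousLinearMap (L y)) s x := by
  classical
  let Φ := ContinuousMultilinearMap.compContinuousLinearMapContinuousMultilinear 𝕜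
    (fun _ : ι => E) (fun _ : ι => E') F
  have hΦL : ContDiffWithinAt 𝕜 n (fun y => Φ fun _ => L y) s x :=
    Φ.contDiff.contDiffAt.comp_contDiffWithinAt x (contDiffWithinAt_pi.2 fun _ => hL)
  have hf' : ContDiffWithinAt 𝕜 n (fun y => (f y).toContinuousMultilinearMap) s x :=
    (ContinuousAlternatingMap.toContinuousMultilinearMapCLM 𝕜 :
      (E' [⋀^ι]→L[𝕜] F) →L[𝕜] _).contDiff.contDiffAt.comp_contDiffWithinAt x hf
  have halt (y : G) : (f y).compContinuousLinearMap (L y) =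
      ((Fintype.card ι).factorial : 𝕜)⁻¹ •
        alternatizationCLM 𝕜 ι E F (Φ (fun _ => L y) (f y).toContinuousMultilinearMap) := by
    change _ = _ • alternatizationCLM 𝕜 ι E F
      ((f y).compContinuousLinearMap (L y)).toContinuousMultilinearMap
    rw [alternatizationCLM_toContinuousMultilinearMap, ← Nat.cast_smul_eq_nsmul 𝕜, smul_smul,
      inv_mul_cancel₀ (Nat.cast_ne_zero.2 (Nat.factorial_ne_zero _)), one_smul]
  simp_rw [halt]
  exact ((alternatizationCLM 𝕜 ι E F).contDiff.contDiffAt.comp_contDiffWithinAt x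
    (hΦL.clm_apply hf')).const_smul _

end AlternatingPullback

section ParametricIntegral

variable {X E F : Type*} [TopologicalSpace X] [MeasurableSpace X] [OpensMeasurableSpace X]
  {μ : Measure X} [IsFiniteMeasureOnCompacts μ] [NormedAddCommGroup E] [NormedAddCommGroup F]
  {C : Set E} {k : Set X}

lemma integrable_slice_of_compact_support [R1Space X] {f : E → X → F} (hk : IsCompact k)
    (hf : ContinuousOn f.uncurry (C ×ˢ univ)) (hfk : ∀ y ∈ C, ∀ x ∉ k, f y x = 0) {y : E}
    (hy : y ∈ C) : Integrable (f y) μ :=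
  (hf.comp_continuous (f := fun x : X => (y, x)) (by fun_prop)
    fun x => ⟨hy, mem_univ x⟩).integrable_of_hasCompactSupport
      (HasCompactSupport.intro hk (hfk y hy))

variable [NormedSpace ℝ E] [NormedSpace ℝ F]

lemma hasFDerivWithinAt_integral_of_compact_support [R1Space X] {f : E → X → F}
    {f' : E → X → E →L[ℝ] F} (hC : Convex ℝ C) (hk : IsCompact k)
    (hf : ContinuousOn f.uncurry (C ×ˢ univ)) (hf' : ContinuousOn f'.uncurry (C ×ˢ univ))
    (hfk : ∀ y ∈ C, ∀ x ∉ k, f y x = 0) (hfk' : ∀ y ∈ C, ∀ x ∉ k, f' y x = 0)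
    (hderiv : ∀ x, ∀ y ∈ C, HasFDerivWithinAt (f · x) (f' y x) C y) {y₀ : E} (hy₀ : y₀ ∈ C) :
    HasFDerivWithinAt (fun y => ∫ x, f y x ∂μ) (∫ x, f' y₀ x ∂μ) C y₀ := by
  have hint {y : E} (hy : y ∈ C) : Integrable (f y) μ :=
    integrable_slice_of_compact_support hk hf hfk hy
  have hint' : Integrable (f' y₀) μ := integrable_slice_of_compact_support hk hf' hfk' hy₀
  rw [hasFDerivWithinAt_iff_isLittleO, Asymptotics.isLittleO_iff]
  intro ε hε
  set c : ℝ := ε / (μ.real k + 1)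
  have hcε : c * μ.real k ≤ ε := by
    rw [div_mul_eq_mul_div, div_le_iff₀ (by positivity)]
    nlinarith [measureReal_nonneg (μ := μ) (s := k)]
  obtain ⟨v, hv, hvc⟩ := hk.mem_uniformity_of_prod (hf'.mono (prod_mono_right (subset_univ k)))
    hy₀ (Metric.dist_mem_uniformity (show 0 < c by positivity))
  obtain ⟨δ, hδ, hδv⟩ := Metric.mem_nhdsWithin_iff.1 hv
  filter_upwards [inter_mem_nhdsWithin C (Metric.ball_mem_nhds y₀ hδ)] with y hy
  have hbound (x : X) (hx : x ∈ k) : ‖f y x - f y₀ x - f' y₀ x (y - y₀)‖ ≤ c * ‖y - y₀‖ := by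
    refine (hC.inter (convex_ball y₀ δ)).norm_image_sub_le_of_norm_hasFDerivWithin_le'
      (fun z hz => (hderiv x z hz.1).mono inter_subset_left) (fun z hz => ?_)
      ⟨hy₀, Metric.mem_ball_self hδ⟩ hy
    rw [← dist_eq_norm]
    exact (hvc z (hδv ⟨hz.2, hz.1⟩) x hx).le
  calc ‖∫ x, f y x ∂μ - ∫ x, f y₀ x ∂μ - (∫ x, f' y₀ x ∂μ) (y - y₀)‖
      = ‖∫ x, (f y x - f y₀ x - f' y₀ x (y - y₀)) ∂μ‖ := by
        rw [integral_sub (f := fun x => f y x - f y₀ x) ((hint hy.1).sub (hint hy₀))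
          (hint'.apply_continuousLinearMap _), integral_sub (hint hy.1) (hint hy₀),
          ContinuousLinearMap.integral_apply hint']
    _ = ‖∫ x in k, (f y x - f y₀ x - f' y₀ x (y - y₀)) ∂μ‖ := by
        rw [setIntegral_eq_integral_of_forall_compl_eq_zero fun x hx => by
          simp [hfk y hy.1 x hx, hfk y₀ hy₀ x hx, hfk' y₀ hy₀ x hx]]
    _ ≤ c * ‖y - y₀‖ * μ.real k :=
        norm_setIntegral_le_of_norm_le_const hk.measure_lt_top hbound
    _ = c * μ.real k * ‖y - y₀‖ := mul_right_comm ..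
    _ ≤ ε * ‖y - y₀‖ := by gcongr

end ParametricIntegral

section ParametricIntegralSmooth

variable {X E F : Type*} [NormedAddCommGroup X] [NormedSpace ℝ X] [NormedAddCommGroup E]
  [NormedSpace ℝ E] [NormedAddCommGroup F] [NormedSpace ℝ F] {C : Set E} {k : Set X}

variable (X E F) in
/-- The restriction to the directions in `E` of a multilinear map on `E × X`, used to turn a Taylor
series in both variables into one in the first variable. -/
abbrev restrictFst (m : ℕ) : ((E × X) [×m]→L[ℝ] F) →L[ℝ] E [×m]→L[ℝ] F :=
  ContinuousMultilinearMap.compContinuousLinearMapL fun _ => ContinuousLinearMap.inl ℝ E X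

lemma hasFDerivWithinAt_restrictFst_slice {n : ℕ∞ω} {f : E × X → F}
    {q : E × X → FormalMultilinearSeries ℝ (E × X) F}
    (hq : HasFTaylorSeriesUpToOn n f q (C ×ˢ univ)) {m : ℕ} (hm : m < n) {y : E} (hy : y ∈ C)
    (x : X) : HasFDerivWithinAt (fun z => restrictFst X E F m (q (z, x) m))
      (restrictFst X E F (m + 1) (q (y, x) (m + 1))).curryLeft C y := by
  have hslice : HasFDerivWithinAt (fun z => q (z, x) m)
      ((q (y, x) (m + 1)).curryLeft.comp (ContinuousLinearMap.inl ℝ E X)) C y :=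
    HasFDerivWithinAt.comp (g := fun z => q z m) (f := fun z => (z, x)) (t := C ×ˢ univ) y
      (hq.fderivWithin m hm (y, x) ⟨hy, mem_univ x⟩)
      (hasFDerivAt_prodMk_left y x).hasFDerivWithinAt fun z hz => ⟨hz, mem_univ x⟩
  refine ((restrictFst X E F m).hasFDerivAt.comp_hasFDerivWithinAt y hslice).congr_fderiv ?_
  ext v w
  change q (y, x) (m + 1) (Fin.cons _ _) = q (y, x) (m + 1) _
  congr 1
  funext i
  refine Fin.cases ?_ (fun j => ?_) i <;> rfl

lemma integral_curryLeft {Ω : Type*} [MeasurableSpace Ω] {ν : Measure Ω} {m : ℕ}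
    (f : Ω → E [×m + 1]→L[ℝ] F) : ∫ a, (f a).curryLeft ∂ν = (∫ a, f a ∂ν).curryLeft :=
  ContinuousLinearEquiv.integral_comp_comm (𝕜 := ℝ) (E := E [×m + 1]→L[ℝ] F)
    (F := E →L[ℝ] E [×m]→L[ℝ] F)
    (continuousMultilinearCurryLeftEquiv ℝ (fun _ : Fin (m + 1) => E) F).toContinuousLinearEquiv f

variable [MeasurableSpace X] [OpensMeasurableSpace X] {μ : Measure X}
  [IsFiniteMeasureOnCompacts μ]

lemma hasFTaylorSeriesUpToOn_integral_of_compact_support {n : ℕ∞ω} {f : E → X → F}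
    {q : E × X → FormalMultilinearSeries ℝ (E × X) F} (hC : Convex ℝ C) (hk : IsCompact k)
    (hq : HasFTaylorSeriesUpToOn n f.uncurry q (C ×ˢ univ))
    (hqk : ∀ y ∈ C, ∀ x ∉ k, ∀ m, q (y, x) m = 0) :
    HasFTaylorSeriesUpToOn n (fun y => ∫ x, f y x ∂μ)
      (fun y m => ∫ x, restrictFst X E F m (q (y, x) m) ∂μ) C := by
  have hcont (m : ℕ) (hm : m ≤ n) :
      ContinuousOn (Function.uncurry fun y x => restrictFst X E F m (q (y, x) m)) (C ×ˢ univ) :=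
    (restrictFst X E F m).continuous.comp_continuousOn (hq.cont m hm)
  have hzero (m : ℕ) (y : E) (hy : y ∈ C) (x : X) (hx : x ∉ k) :
      restrictFst X E F m (q (y, x) m) = 0 := by rw [hqk y hy x hx, map_zero]
  refine ⟨fun y hy => ?_, fun m hm y hy => ?_, fun m hm => ?_⟩
  · have hcurry := (continuousMultilinearCurryFin0 ℝ E F).toContinuousLinearEquiv.integral_comp_comm
      (μ := μ) fun x => restrictFst X E F 0 (q (y, x) 0)
    refine hcurry.symm.trans (integral_congr_ae (Filter.Eventually.of_forall fun x => ?_))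
    exact (congrArg (q (y, x) 0) (Subsingleton.elim _ _)).trans (hq.zero_eq (y, x) ⟨hy, mem_univ x⟩)
  · have hcont' : ContinuousOn (Function.uncurry fun y x =>
        (restrictFst X E F (m + 1) (q (y, x) (m + 1))).curryLeft) (C ×ˢ univ) :=
      (continuousMultilinearCurryLeftEquiv ℝ (fun _ : Fin (m + 1) => E) F).continuous
        |>.comp_continuousOn (hcont (m + 1) (ENat.add_one_natCast_le_withTop_of_lt hm))
    exact (hasFDerivWithinAt_integral_of_compact_support hC hk (hcont m hm.le) hcont' (hzero m)
      (fun z hz x hx => congrArg ContinuousMultilinearMap.curryLeft (hzero (m + 1) z hz x hx))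
      (fun x z hz => hasFDerivWithinAt_restrictFst_slice hq hm hz x) hy).congr_fderiv
      (integral_curryLeft _)
  · exact continuousOn_integral_of_compact_support hk (hcont m hm) fun y x hy hx =>
      hzero m y hy x hx

lemma contDiffOn_integral_of_compact_support {n : ℕ∞} {f : E → X → F} (hC : Convex ℝ C)
    (hCu : UniqueDiffOn ℝ C) (hk : IsCompact k) (hf : ContDiffOn ℝ n f.uncurry (C ×ˢ univ))
    (hfk : ∀ y ∈ C, ∀ x ∉ k, f y x = 0) : ContDiffOn ℝ n (fun y => ∫ x, f y x ∂μ) C := by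
  refine (hasFTaylorSeriesUpToOn_integral_of_compact_support hC hk
    (hf.ftaylorSeriesWithin (hCu.prod uniqueDiffOn_univ)) fun y hy x hx m => ?_).contDiffOn
  have hloc : f.uncurry =ᶠ[𝓝[C ×ˢ univ] (y, x)] fun _ => 0 := by
    filter_upwards [self_mem_nhdsWithin, nhdsWithin_le_nhds
      (continuous_snd.continuousAt.preimage_mem_nhds (hk.isClosed.isOpen_compl.mem_nhds hx))]
      with z hz hzk using hfk z.1 hz.1 z.2 hzk
  rw [ftaylorSeriesWithin, hloc.iteratedFDerivWithin_eq (hfk y hy x hx),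
    iteratedFDerivWithin_fun_zero, Pi.zero_apply]

end ParametricIntegralSmooth

section Pullback

variable {E H M : Type*} [NormedAddCommGroup E] [NormedSpace ℝ E] [TopologicalSpace H]
  {I : ModelWithCorners ℝ E H} [TopologicalSpace M] [ChartedSpace H M] {k : ℕ}
  {η η' : M → E [⋀^Fin k]→L[ℝ] ℝ} {p : M}

variable (I) in
/-- Smoothness of a form at a point, in all charts around that point. This is the pointwise version
of membership in `smoothForms`. -/
def FormSmoothAt (η : M → E [⋀^Fin k]→L[ℝ] ℝ) (p : M) : Prop :=
  ∀ x₀ : M, p ∈ (extChartAt I x₀).source →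
    ContDiffWithinAt ℝ ∞ (formInChart I η x₀) (range I) (extChartAt I x₀ p)

lemma mem_smoothForms_iff_formSmoothAt : η ∈ smoothForms I M k ↔ ∀ p, FormSmoothAt I η p := by
  refine ⟨fun hη p x₀ hp => ?_, fun hη x₀ y hy => ?_⟩
  · exact (hη x₀ _ ((extChartAt I x₀).map_source hp)).mono_of_mem_nhdsWithin
      (extChartAt_target_mem_nhdsWithin' hp)
  · have h := hη _ x₀ ((extChartAt I x₀).map_target hy)
    rw [(extChartAt I x₀).right_inv hy] at h
    exact h.mono (extChartAt_target_subset_range x₀)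

lemma FormSmoothAt.congr_of_eventuallyEq (hη : FormSmoothAt I η p) (h : η' =ᶠ[𝓝 p] η) :
    FormSmoothAt I η' p := by
  intro x₀ hp
  have hsymm : ∀ᶠ y in 𝓝 (extChartAt I x₀ p),
      η' ((extChartAt I x₀).symm y) = η ((extChartAt I x₀).symm y) :=
    (continuousAt_extChartAt_symm' hp).eventually
      (by rwa [(extChartAt I x₀).left_inv hp])
  refine (hη x₀ hp).congr_of_eventuallyEq_of_mem ?_ (mem_range_self _)
  filter_upwards [mem_nhdsWithin_of_mem_nhds hsymm] with y hy
  rw [formInChart, formInChart, hy]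

variable {E' H' M' : Type*} [NormedAddCommGroup E'] [NormedSpace ℝ E'] [TopologicalSpace H']
  {I' : ModelWithCorners ℝ E' H'} [TopologicalSpace M'] [ChartedSpace H' M']
  {E'' H'' M'' : Type*} [NormedAddCommGroup E''] [NormedSpace ℝ E''] [TopologicalSpace H'']
  {I'' : ModelWithCorners ℝ E'' H''} [TopologicalSpace M''] [ChartedSpace H'' M'']
  {f : M → M'} {β : M' → E' [⋀^Fin k]→L[ℝ] ℝ}

lemma formPullback_comp {g : M' → M''} (hg : MDifferentiableAt I' I'' g (f p))
    (hf : MDifferentiableAt I I' f p) (β : M'' → E'' [⋀^Fin k]→L[ℝ] ℝ) :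
    formPullback I I'' (g ∘ f) β p = formPullback I I' f (formPullback I' I'' g β) p := by
  ext v
  simp only [formPullback, modelDeriv, mfderiv_comp p hg hf]
  rfl

lemma formPullback_of_eventuallyEq_id {f : M → M} (hf : f =ᶠ[𝓝 p] id) :
    formPullback I I f η p = η p := by
  ext v
  simp only [formPullback, modelDeriv, hf.mfderiv_eq, mfderiv_id, hf.self_of_nhds]
  rfl

lemma formPullback_add (β β' : M' → E' [⋀^Fin k]→L[ℝ] ℝ) :
    formPullback I I' f (β + β') = formPullback I I' f β + formPullback I I' f β' := rfl

lemma formPullback_smul (c : ℝ) (β : M' → E' [⋀^Fin k]→L[ℝ] ℝ) :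
    formPullback I I' f (c • β) = c • formPullback I I' f β := rfl

lemma contDiffWithinAt_chart_representation {n : ℕ∞ω} [IsManifold I n M] [IsManifold I' n M']
    {x₀ : M} {x₁ : M'} (hp : p ∈ (extChartAt I x₀).source) (hf : ContMDiffAt I I' n f p)
    (hx₁ : f p ∈ (extChartAt I' x₁).source) :
    ContDiffWithinAt ℝ n (fun y => extChartAt I' x₁ (f ((extChartAt I x₀).symm y))) (range I)
      (extChartAt I x₀ p) := by
  rw [← contMDiffWithinAt_iff_contDiffWithinAt]
  have hsymm := (extChartAt I x₀).left_inv hp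
  refine ((contMDiffAt_extChartAt' (by rwa [hsymm, ← extChartAt_source I'])).comp _
    (by rwa [hsymm])).comp_contMDiffWithinAt _
    (contMDiffWithinAt_extChartAt_symm_range x₀ ((extChartAt I x₀).map_source hp))

lemma hasMFDerivWithinAt_extChartAt_symm [IsManifold I 1 M] {x₀ : M} {y : E}
    (hy : y ∈ (extChartAt I x₀).target) :
    HasMFDerivWithinAt 𝓘(ℝ, E) I (extChartAt I x₀).symm (range I) y
      (chartInvDeriv (E := E) I x₀ y) :=
  (mdifferentiableWithinAt_extChartAt_symm hy).hasMFDerivWithinAt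

lemma chartInvDeriv_comp_fderivWithin [IsManifold I 1 M] [IsManifold I' 1 M'] {x₀ : M} {x₁ : M'}
    (hp : p ∈ (extChartAt I x₀).source) (hf : ContMDiffAt I I' 1 f p)
    (hx₁ : f p ∈ (extChartAt I' x₁).source) :
    (chartInvDeriv I' x₁ (extChartAt I' x₁ (f p))).comp
      (fderivWithin ℝ (fun y => extChartAt I' x₁ (f ((extChartAt I x₀).symm y))) (range I)
        (extChartAt I x₀ p)) =
    (modelDeriv I I' f p).comp (chartInvDeriv I x₀ (extChartAt I x₀ p)) := by
  set ψ : E → E' := fun z => extChartAt I' x₁ (f ((extChartAt I x₀).symm z))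
  set y := extChartAt I x₀ p
  have hy : y ∈ (extChartAt I x₀).target := (extChartAt I x₀).map_source hp
  have hyp : (extChartAt I x₀).symm y = p := (extChartAt I x₀).left_inv hp
  have hψy : ψ y = extChartAt I' x₁ (f p) := by simp only [ψ, hyp]
  have hleft : HasMFDerivWithinAt 𝓘(ℝ, E) I' ((extChartAt I' x₁).symm ∘ ψ) (range I) y
      ((chartInvDeriv (E := E') I' x₁ (extChartAt I' x₁ (f p))).comp
        (fderivWithin ℝ ψ (range I) y)) := by
    rw [← hψy]
    refine HasMFDerivWithinAt.comp y (hasMFDerivWithinAt_extChartAt_symm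
      (by rw [hψy]; exact (extChartAt I' x₁).map_source hx₁)) ?_
      fun z _ => mem_range_self _
    exact ((contDiffWithinAt_chart_representation hp hf hx₁).differentiableWithinAt
      one_ne_zero).hasFDerivWithinAt.hasMFDerivWithinAt
  have hright : HasMFDerivWithinAt 𝓘(ℝ, E) I' (f ∘ (extChartAt I x₀).symm) (range I) y
      ((modelDeriv (E := E) (E' := E') I I' f p).comp (chartInvDeriv (E := E) I x₀ y)) := by
    rw [← hyp] at hf ⊢
    exact (hf.mdifferentiableAt one_ne_zero).hasMFDerivAt.comp_hasMFDerivWithinAt y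
      (hasMFDerivWithinAt_extChartAt_symm hy)
  have hcongr : (extChartAt I' x₁).symm ∘ ψ =ᶠ[𝓝[range I] y] f ∘ (extChartAt I x₀).symm := by
    filter_upwards [hright.1.preimage_mem_nhdsWithin (extChartAt_source_mem_nhds'
      (by rwa [Function.comp_apply, hyp]))] with z hz using (extChartAt I' x₁).left_inv hz
  have hyI := extChartAt_target_subset_range x₀ hy
  exact (I.uniqueDiffOn.uniqueMDiffOn _ hyI).eq hleft
    (hright.congr_of_eventuallyEq hcongr (hcongr.self_of_nhdsWithin hyI))

lemma formInChart_formPullback [IsManifold I 1 M] [IsManifold I' 1 M']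
    (β : M' → E' [⋀^Fin k]→L[ℝ] ℝ) {x₀ : M} {x₁ : M'} (hp : p ∈ (extChartAt I x₀).source)
    (hf : ContMDiffAt I I' 1 f p) (hx₁ : f p ∈ (extChartAt I' x₁).source) :
    formInChart I (formPullback I I' f β) x₀ (extChartAt I x₀ p) =
      (formInChart I' β x₁ (extChartAt I' x₁ (f p))).compContinuousLinearMap
        (fderivWithin ℝ (fun y => extChartAt I' x₁ (f ((extChartAt I x₀).symm y))) (range I)
          (extChartAt I x₀ p)) := by
  have hchain := chartInvDeriv_comp_fderivWithin hp hf hx₁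
  ext v
  simp only [formInChart, formPullback, (extChartAt I x₀).left_inv hp,
    (extChartAt I' x₁).left_inv hx₁, ContinuousAlternatingMap.compContinuousLinearMap_apply]
  congr 1
  funext i
  exact (DFunLike.congr_fun hchain (v i)).symm

variable [IsManifold I ∞ M] [IsManifold I' ∞ M']

lemma FormSmoothAt.formPullback (hβ : FormSmoothAt I' β (f p)) (hf : ContMDiffAt I I' ∞ f p) :
    FormSmoothAt I (formPullback I I' f β) p := by
  intro x₀ hp
  have hrange : extChartAt I x₀ p ∈ range I := mem_range_self _
  have hsymm := (extChartAt I x₀).left_inv hp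
  set φ : E → E' := fun y => extChartAt I' (f p) (f ((extChartAt I x₀).symm y))
  have hφ : ContDiffWithinAt ℝ ∞ φ (range I) (extChartAt I x₀ p) :=
    contDiffWithinAt_chart_representation hp hf (mem_extChartAt_source (f p))
  have hβφ : ContDiffWithinAt ℝ ∞ (formInChart I' β (f p) ∘ φ) (range I) (extChartAt I x₀ p) :=
    ContDiffWithinAt.comp (t := range I') _
      (by simpa only [φ, hsymm] using hβ (f p) (mem_extChartAt_source (f p))) hφ
      fun y _ => mem_range_self _
  have hφ' : ContDiffWithinAt ℝ ∞ (fderivWithin ℝ φ (range I)) (range I) (extChartAt I x₀ p) :=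
    hφ.fderivWithin_right I.uniqueDiffOn (m := ∞) le_rfl hrange
  refine (contDiffWithinAt_alternatingMap_compContinuousLinearMap hβφ
    hφ').congr_of_eventuallyEq_of_mem ?_ hrange
  have hf₁ : ∀ᶠ q in 𝓝 p, ContMDiffAt I I' 1 f q :=
    (contMDiffAt_iff_contMDiffAt_nhds (by simp)).1 (hf.of_le (by simp))
  have hsource : ∀ᶠ q in 𝓝 p, f q ∈ (extChartAt I' (f p)).source :=
    hf.continuousAt.eventually (extChartAt_source_mem_nhds (f p))
  have hsymm_tendsto := (continuousAt_extChartAt_symm' hp).tendsto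
  rw [hsymm] at hsymm_tendsto
  filter_upwards [mem_nhdsWithin_of_mem_nhds (hsymm_tendsto.eventually (hf₁.and hsource)),
    extChartAt_target_mem_nhdsWithin' hp] with y ⟨hfy, hfy'⟩ hy
  have h := formInChart_formPullback β ((extChartAt I x₀).map_target hy) hfy hfy'
  rwa [(extChartAt I x₀).right_inv hy] at h

lemma formPullback_mem_smoothForms (hf : ContMDiff I I' ∞ f) (hβ : β ∈ smoothForms I' M' k) :
    formPullback I I' f β ∈ smoothForms I M k :=
  mem_smoothForms_iff_formSmoothAt.2 fun p =>
    (mem_smoothForms_iff_formSmoothAt.1 hβ (f p)).formPullback (hf p)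

/-- Smoothness descends along maps with smooth local sections: near `b`, the form `β` is the
pullback of `f^* β` along a section. -/
lemma mem_smoothForms_of_formPullback_mem (hf : ContMDiff I I' ∞ f)
    (hsection : ∀ b, ∃ U ∈ 𝓝 b, ∃ σ : M' → M, ContMDiffOn I' I ∞ σ U ∧ ∀ c ∈ U, f (σ c) = c)
    (hβ : formPullback I I' f β ∈ smoothForms I M k) : β ∈ smoothForms I' M' k := by
  refine mem_smoothForms_iff_formSmoothAt.2 fun b => ?_
  obtain ⟨U, hU, σ, hσ, hfσ⟩ := hsection b
  have hσb : ContMDiffAt I' I ∞ σ b := (hσ b (mem_of_mem_nhds hU)).contMDiffAt hU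
  refine ((mem_smoothForms_iff_formSmoothAt.1 hβ (σ b)).formPullback
    hσb).congr_of_eventuallyEq ?_
  filter_upwards [eventually_eventually_nhds.2 hU] with c hc
  have hσc : ContMDiffAt I' I ∞ σ c := (hσ c (mem_of_mem_nhds hc)).contMDiffAt hc
  rw [← formPullback_comp ((hf (σ c)).mdifferentiableAt (by simp))
    (hσc.mdifferentiableAt (by simp))]
  refine (formPullback_of_eventuallyEq_id ?_).symm
  filter_upwards [hc] with z hz using hfσ z hz

/-- The pullback of smooth forms along a smooth map, as a linear map. -/
def smoothFormsPullback (hf : ContMDiff I I' ∞ f) (k : ℕ) :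
    smoothForms I' M' k →ₗ[ℝ] smoothForms I M k where
  toFun β := ⟨formPullback I I' f β.1, formPullback_mem_smoothForms hf β.2⟩
  map_add' β β' := Subtype.ext (formPullback_add β.1 β'.1)
  map_smul' c β := Subtype.ext (formPullback_smul c β.1)

end Pullback

section FiberwiseCompactSupport

variable {X M V : Type*} [TopologicalSpace X] [TopologicalSpace M] {f g : X × M → V}

/-- The function `f` on `X × M` has compact support along `X`, locally uniformly in `M`. -/
def HasFiberwiseCompactSupport [Zero V] (f : X × M → V) : Prop :=
  ∀ p, ∃ W ∈ 𝓝 p, ∃ K : Set X, IsCompact K ∧ ∀ q ∈ W, ∀ s ∉ K, f (s, q) = 0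

lemma HasFiberwiseCompactSupport.zero [Zero V] :
    HasFiberwiseCompactSupport (0 : X × M → V) := fun _ =>
  ⟨univ, Filter.univ_mem, ∅, isCompact_empty, fun _ _ _ _ => rfl⟩

lemma HasFiberwiseCompactSupport.mono [Zero V] {V' : Type*} [Zero V'] {f' : X × M → V'}
    (hf : HasFiberwiseCompactSupport f) (h : ∀ x, f x = 0 → f' x = 0) :
    HasFiberwiseCompactSupport f' := fun p =>
  let ⟨W, hW, K, hK, hWK⟩ := hf p
  ⟨W, hW, K, hK, fun q hq s hs => h _ (hWK q hq s hs)⟩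

lemma HasFiberwiseCompactSupport.add [AddZeroClass V] (hf : HasFiberwiseCompactSupport f)
    (hg : HasFiberwiseCompactSupport g) : HasFiberwiseCompactSupport (f + g) := by
  intro p
  obtain ⟨W, hW, K, hK, hf⟩ := hf p
  obtain ⟨W', hW', K', hK', hg⟩ := hg p
  refine ⟨W ∩ W', Filter.inter_mem hW hW', K ∪ K', hK.union hK', fun q hq s hs => ?_⟩
  rw [mem_union, not_or] at hs
  rw [Pi.add_apply, hf q hq.1 s hs.1, hg q hq.2 s hs.2, add_zero]

end FiberwiseCompactSupport

section FiberIntegration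

variable {E H M : Type*} [NormedAddCommGroup E] [NormedSpace ℝ E] [TopologicalSpace H]
  {I : ModelWithCorners ℝ E H} {k : ℕ} {β : ℝ × M → (ℝ × E) [⋀^Fin (k + 1)]→L[ℝ] ℝ}

variable (E k) in
/-- Contraction of a form on `ℝ × E` with the unit vector of `ℝ`, restricted to `E`. -/
def contractTime : ((ℝ × E) [⋀^Fin (k + 1)]→L[ℝ] ℝ) →L[ℝ] E [⋀^Fin k]→L[ℝ] ℝ :=
  (ContinuousAlternatingMap.compContinuousLinearMapCLM (ContinuousLinearMap.inr ℝ ℝ E)).comp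
    ((ContinuousLinearMap.apply ℝ _ ((1, 0) : ℝ × E)).comp
      (ContinuousAlternatingMap.curryLeftLI (𝕜 := ℝ) (E := ℝ × E) (F := ℝ)
        (n := k)).toContinuousLinearMap)

lemma prIntegrand_eq_contractTime (β : ℝ × M → (ℝ × E) [⋀^Fin (k + 1)]→L[ℝ] ℝ) (p : M) (s : ℝ) :
    prIntegrand β p s = contractTime E k (β (s, p)) := rfl

lemma contractTime_compContinuousLinearMap (φ : (ℝ × E) [⋀^Fin (k + 1)]→L[ℝ] ℝ) (L : E →L[ℝ] E) :
    (contractTime E k φ).compContinuousLinearMap L =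
      contractTime E k (φ.compContinuousLinearMap ((ContinuousLinearMap.id ℝ ℝ).prodMap L)) := by
  ext v
  refine congrArg φ (funext fun i => ?_)
  refine Fin.cases ?_ (fun j => ?_) i <;> simp

variable [TopologicalSpace M] [ChartedSpace H M]

variable (I) in
/-- The smooth `k`-forms on `ℝ × M` with compact support along `ℝ`, locally uniformly in `M`. -/
def fiberwiseCompactForms (M : Type*) [TopologicalSpace M] [ChartedSpace H M] (k : ℕ) :
    Submodule ℝ (ℝ × M → (ℝ × E) [⋀^Fin k]→L[ℝ] ℝ) where
  carrier := {β | β ∈ smoothForms (𝓘(ℝ, ℝ).prod I) (ℝ × M) k ∧ HasFiberwiseCompactSupport β}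
  zero_mem' := ⟨Submodule.zero_mem _, .zero⟩
  add_mem' h h' := ⟨Submodule.add_mem _ h.1 h'.1, h.2.add h'.2⟩
  smul_mem' c β h := ⟨Submodule.smul_mem _ c h.1, h.2.mono fun x hx => by simp [hx]⟩

lemma extChartAt_real_prod (x₀ : M) : extChartAt (𝓘(ℝ, ℝ).prod I) ((0 : ℝ), x₀) =
    (PartialEquiv.refl ℝ).prod (extChartAt I x₀) := by
  rw [extChartAt_prod, extChartAt_model_space_eq_id]

lemma chartInvDeriv_real_prod [IsManifold I 1 M] {x₀ : M} {y : E}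
    (hy : y ∈ (extChartAt I x₀).target) (s : ℝ) :
    chartInvDeriv (𝓘(ℝ, ℝ).prod I) ((0 : ℝ), x₀) (s, y) =
      (ContinuousLinearMap.id ℝ ℝ).prodMap (chartInvDeriv I x₀ y) := by
  have hrange : range (𝓘(ℝ, ℝ).prod I) = (univ : Set ℝ) ×ˢ range I := by
    rw [ModelWithCorners.range_prod, modelWithCornersSelf_coe, range_id]
  have hprod : HasMFDerivWithinAt 𝓘(ℝ, ℝ × E) (𝓘(ℝ, ℝ).prod I)
      (Prod.map id (extChartAt I x₀).symm) (univ ×ˢ range I) (s, y)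
      ((ContinuousLinearMap.id ℝ ℝ).prodMap (chartInvDeriv (E := E) I x₀ y)) := by
    rw [modelWithCornersSelf_prod, ← chartedSpaceSelf_prod]
    exact (hasMFDerivAt_id s).hasMFDerivWithinAt.prodMap
      ((hasMFDerivWithinAt_extChartAt_symm hy).mono (snd_image_prod_subset ..))
  have hunique : UniqueMDiffWithinAt 𝓘(ℝ, ℝ × E) ((univ : Set ℝ) ×ˢ range I) (s, y) :=
    (uniqueDiffOn_univ.prod I.uniqueDiffOn).uniqueMDiffOn _
      ⟨mem_univ _, extChartAt_target_subset_range x₀ hy⟩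
  rw [chartInvDeriv, hrange, extChartAt_real_prod]
  exact hprod.mfderivWithin hunique

lemma prIntegrand_comp_chartInvDeriv [IsManifold I 1 M]
    (β : ℝ × M → (ℝ × E) [⋀^Fin (k + 1)]→L[ℝ] ℝ) {x₀ : M} {y : E}
    (hy : y ∈ (extChartAt I x₀).target) (s : ℝ) :
    (prIntegrand β ((extChartAt I x₀).symm y) s).compContinuousLinearMap (chartInvDeriv I x₀ y) =
      contractTime E k (formInChart (𝓘(ℝ, ℝ).prod I) β ((0 : ℝ), x₀) (s, y)) := by
  have hp : (extChartAt (𝓘(ℝ, ℝ).prod I) ((0 : ℝ), x₀)).symm (s, y) =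
      (s, (extChartAt I x₀).symm y) := by
    rw [extChartAt_real_prod]; rfl
  rw [prIntegrand_eq_contractTime, contractTime_compContinuousLinearMap, formInChart, hp,
    chartInvDeriv_real_prod hy]

lemma contDiffOn_contractTime_formInChart
    (hβ : β ∈ smoothForms (𝓘(ℝ, ℝ).prod I) (ℝ × M) (k + 1)) (x₀ : M) :
    ContDiffOn ℝ ∞ (fun z : E × ℝ =>
      contractTime E k (formInChart (𝓘(ℝ, ℝ).prod I) β ((0 : ℝ), x₀) (z.2, z.1)))
      ((extChartAt I x₀).target ×ˢ univ) := by
  have hβ₀ := hβ ((0 : ℝ), x₀)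
  rw [extChartAt_real_prod] at hβ₀
  exact (contractTime E k).contDiff.comp_contDiffOn <|
    hβ₀.comp (contDiff_snd.prodMk contDiff_fst).contDiffOn fun z hz => ⟨mem_univ _, hz.1⟩

variable [IsManifold I 1 M]

lemma continuous_prIntegrand (hβ : β ∈ smoothForms (𝓘(ℝ, ℝ).prod I) (ℝ × M) (k + 1)) (p : M) :
    Continuous (prIntegrand β p) := by
  have hy : extChartAt I p p ∈ (extChartAt I p).target := mem_extChartAt_target p
  obtain ⟨R, hR⟩ : ∃ R : E →L[ℝ] E, ∀ v, chartInvDeriv I p (extChartAt I p p) (R v) = v := by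
    obtain ⟨L, hL⟩ := isInvertible_mfderivWithin_extChartAt_symm hy
    exact ⟨L.symm.toContinuousLinearMap, fun v =>
      (DFunLike.congr_fun hL (L.symm v)).symm.trans (L.apply_symm_apply v)⟩
  have hchart : Continuous fun s : ℝ =>
      contractTime E k (formInChart (𝓘(ℝ, ℝ).prod I) β ((0 : ℝ), p) (s, extChartAt I p p)) :=
    (contDiffOn_contractTime_formInChart hβ p).continuousOn.comp_continuous
      (f := fun s => (extChartAt I p p, s)) (by fun_prop) fun s => ⟨hy, mem_univ s⟩
  refine ((ContinuousAlternatingMap.compContinuousLinearMapCLM (ι := Fin k) (F := ℝ)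
    R).continuous.comp hchart).congr fun s => ?_
  rw [Function.comp_apply, ← prIntegrand_comp_chartInvDeriv β hy, extChartAt_to_inv]
  ext v
  exact congrArg (prIntegrand β p s) (funext fun i => hR (v i))

lemma integrable_prIntegrand (hβ : β ∈ fiberwiseCompactForms I M (k + 1)) (p : M) :
    Integrable (prIntegrand β p) := by
  obtain ⟨W, hW, K, hK, hWK⟩ := hβ.2 p
  refine (continuous_prIntegrand hβ.1 p).integrable_of_hasCompactSupport
    (HasCompactSupport.intro hK fun s hs => ?_)
  rw [prIntegrand_eq_contractTime, hWK p (mem_of_mem_nhds hW) s hs, map_zero]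

lemma formInChart_prIntegral (hβ : β ∈ fiberwiseCompactForms I M (k + 1)) (A : Set ℝ) {x₀ : M}
    {y : E} (hy : y ∈ (extChartAt I x₀).target) :
    formInChart I (prIntegral A β) x₀ y =
      ∫ s in A, contractTime E k (formInChart (𝓘(ℝ, ℝ).prod I) β ((0 : ℝ), x₀) (s, y)) := by
  simp_rw [← prIntegrand_comp_chartInvDeriv β hy]
  exact ((ContinuousAlternatingMap.compContinuousLinearMapCLM (ι := Fin k) (F := ℝ)
    (chartInvDeriv I x₀ y)).integral_comp_comm (integrable_prIntegrand hβ _).integrableOn).symm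

lemma prIntegral_mem_smoothForms (hβ : β ∈ fiberwiseCompactForms I M (k + 1)) (A : Set ℝ) :
    prIntegral A β ∈ smoothForms I M k := by
  intro x₀ y₀ hy₀
  obtain ⟨W, hW, K, hK, hWK⟩ := hβ.2 ((extChartAt I x₀).symm y₀)
  have hnhds : (extChartAt I x₀).target ∩ (extChartAt I x₀).symm ⁻¹' W ∈ 𝓝[range I] y₀ :=
    Filter.inter_mem (extChartAt_target_mem_nhdsWithin_of_mem hy₀)
      ((hasMFDerivWithinAt_extChartAt_symm hy₀).1.preimage_mem_nhdsWithin hW)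
  obtain ⟨δ, hδ, hδW⟩ := Metric.mem_nhdsWithin_iff.1 hnhds
  rw [inter_comm] at hδW
  have hy₀I : y₀ ∈ range I := extChartAt_target_subset_range x₀ hy₀
  have hsmooth : ContDiffOn ℝ ∞ (fun y => ∫ s in A,
      contractTime E k (formInChart (𝓘(ℝ, ℝ).prod I) β ((0 : ℝ), x₀) (s, y)))
      (range I ∩ Metric.ball y₀ δ) := by
    refine contDiffOn_integral_of_compact_support (I.convex_range.inter (convex_ball _ _))
      (I.uniqueDiffOn.inter Metric.isOpen_ball) hK
      ((contDiffOn_contractTime_formInChart hβ.1 x₀).mono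
        (prod_mono_left fun y hy => (hδW hy).1)) fun y hy s hs => ?_
    rw [← prIntegrand_comp_chartInvDeriv β (hδW hy).1, prIntegrand_eq_contractTime,
      hWK _ (hδW hy).2 s hs, map_zero]
    rfl
  exact ((hsmooth.congr fun y hy => formInChart_prIntegral hβ A (hδW hy).1) y₀
    ⟨hy₀I, Metric.mem_ball_self hδ⟩).mono_of_mem_nhdsWithin (nhdsWithin_mono _
      (extChartAt_target_subset_range x₀)
      (inter_mem_nhdsWithin _ (Metric.ball_mem_nhds y₀ hδ)))

/-- Integration over the fibers of `A × M → M`, as a linear map. -/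
def prIntegralLinearMap (A : Set ℝ) :
    fiberwiseCompactForms I M (k + 1) →ₗ[ℝ] smoothForms I M k where
  toFun β := ⟨prIntegral A β.1, prIntegral_mem_smoothForms β.2 A⟩
  map_add' β β' := Subtype.ext <| funext fun p => integral_add
    (integrable_prIntegrand β.2 p).integrableOn (integrable_prIntegrand β'.2 p).integrableOn
  map_smul' c β := Subtype.ext <| funext fun p => integral_smul c (prIntegrand β.1 p)

lemma prIntegral_univ (hβ : β ∈ fiberwiseCompactForms I M (k + 1)) :
    prIntegral univ β = prIntegral (Iic 0) β + prIntegral (Ici 0) β := by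
  ext1 p
  rw [Pi.add_apply, prIntegral, prIntegral, prIntegral, integral_Ici_eq_integral_Ioi,
    intervalIntegral.integral_Iic_add_Ioi (integrable_prIntegrand hβ p).integrableOn
      (integrable_prIntegrand hβ p).integrableOn, setIntegral_univ]

end FiberIntegration

section ProperAction

lemma hasFiberwiseCompactSupport_vadd {G X V : Type*} [TopologicalSpace G] [AddGroup G]
    [WeaklyLocallyCompactSpace G] [TopologicalSpace X] [AddAction G X] [ProperVAdd G X] [Zero V]
    {f : X → V} (hf : HasCompactSupport f) :
    HasFiberwiseCompactSupport fun z : G × X => f (z.1 +ᵥ z.2) := by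
  intro p
  have hproper := ProperVAdd.isProperMap_vadd_pair (G := G) (X := X)
  obtain ⟨K, hK, htimes⟩ := exists_compact_superset
    ((hproper.isCompact_preimage (hf.isCompact.prod (isCompact_singleton (x := p)))).image
      continuous_fst)
  have hclosed := hproper.isClosedMap _ (isOpen_interior.isClosed_compl.prod isClosed_univ :
    IsClosed ((interior K)ᶜ ×ˢ (univ : Set X)))
  obtain ⟨U, W, -, hW, hU, hpW, hUW⟩ := generalized_tube_lemma hf.isCompact isCompact_singleton
    hclosed.isOpen_compl (t := {p}) <| by
      rintro ⟨x, q⟩ ⟨hx, rfl⟩ ⟨⟨s, q'⟩, ⟨hs, -⟩, hsq⟩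
      obtain ⟨rfl, rfl⟩ := Prod.mk.inj hsq
      exact hs (htimes ⟨(s, q'), ⟨hx, rfl⟩, rfl⟩)
  refine ⟨W, hW.mem_nhds (hpW rfl), K, hK, fun q hq s hs => by_contra fun hne => ?_⟩
  exact hUW (mk_mem_prod (hU (subset_tsupport f hne)) hq)
    ⟨(s, q), ⟨fun h => hs (interior_subset h), mem_univ q⟩, rfl⟩

lemma eq_zero_of_vadd_eq_self {N : Type*} [TopologicalSpace N] [AddAction ℝ N] [ProperVAdd ℝ N]
    {t : ℝ} {p : N} (ht : t +ᵥ p = p) : t = 0 := by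
  have hstab (n : ℕ) : (n • t) +ᵥ p = p := by
    induction n with
    | zero => rw [zero_nsmul, zero_vadd]
    | succ n ih => rw [succ_nsmul, add_vadd, ht, ih]
  have hcompact := ((ProperVAdd.isProperMap_vadd_pair (G := ℝ) (X := N)).isCompact_preimage
    (isCompact_singleton (x := (p, p)))).image continuous_fst
  obtain ⟨R, hR⟩ := hcompact.isBounded.exists_norm_le
  by_contra hne
  obtain ⟨n, hn⟩ := exists_lt_nsmul (norm_pos_iff.2 hne) R
  refine hn.not_ge ?_
  simpa only [nsmul_eq_mul, norm_mul, RCLike.norm_natCast] using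
    hR (n • t) ⟨(n • t, p), Prod.ext (hstab n) rfl, rfl⟩

lemma isClosedEmbedding_vadd_pair {N : Type*} [TopologicalSpace N] [AddAction ℝ N]
    [ProperVAdd ℝ N] : IsClosedEmbedding fun z : ℝ × N => (z.1 +ᵥ z.2, z.2) := by
  have hproper := ProperVAdd.isProperMap_vadd_pair (G := ℝ) (X := N)
  refine .of_continuous_injective_isClosedMap hproper.continuous ?_ hproper.isClosedMap
  rintro ⟨s, p⟩ ⟨t, q⟩ h
  obtain ⟨hst, rfl⟩ := Prod.mk.inj h
  refine Prod.ext (sub_eq_zero.1 (eq_zero_of_vadd_eq_self (p := p) ?_)) rfl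
  rw [sub_eq_neg_add, add_vadd, hst, neg_vadd_vadd]

end ProperAction

section Orbits

variable {N : Type*} [AddAction ℝ N]

lemma orbitMap_eq_iff {p q : N} : orbitMap N p = orbitMap N q ↔ ∃ t : ℝ, t +ᵥ q = p := by
  rw [orbitMap, Quotient.eq]
  exact AddAction.orbitRel_apply

lemma orbitMap_vadd (t : ℝ) (p : N) : orbitMap N (t +ᵥ p) = orbitMap N p :=
  orbitMap_eq_iff.2 ⟨t, rfl⟩

end Orbits

section ConstantCurve

variable {E H M : Type*} [NormedAddCommGroup E] [NormedSpace ℝ E]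
  [TopologicalSpace H] {I : ModelWithCorners ℝ E H} [TopologicalSpace M] [ChartedSpace H M]
  [IsManifold I 1 M]

lemma eventually_eq_of_hasMFDerivAt_zero {γ : ℝ → M}
    (hγ : ∀ t, HasMFDerivAt 𝓘(ℝ, ℝ) I γ t (0 : ℝ →L[ℝ] E)) (t : ℝ) :
    ∀ᶠ s in 𝓝 t, γ s = γ t := by
  obtain ⟨δ, hδ, hsource⟩ := Metric.mem_nhds_iff.1
    ((hγ t).1.preimage_mem_nhds (extChartAt_source_mem_nhds (I := I) (γ t)))
  have hderiv : ∀ s ∈ Metric.ball t δ,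
      HasFDerivAt (extChartAt I (γ t) ∘ γ) (0 : ℝ →L[ℝ] E) s := fun s hs => by
    have hchart := mdifferentiableAt_extChartAt (I := I) (x := γ t) (y := γ s)
      (by rw [← extChartAt_source I]; exact hsource hs)
    exact (hchart.hasMFDerivAt.comp s (hγ s)).hasFDerivAt.congr_fderiv
      (ContinuousLinearMap.comp_zero _)
  filter_upwards [Metric.ball_mem_nhds t hδ] with s hs
  refine (extChartAt I (γ t)).injOn (hsource hs) (mem_extChartAt_source _) ?_
  exact (convex_ball t δ).is_const_of_fderivWithin_eq_zero (𝕜 := ℝ) (f := extChartAt I (γ t) ∘ γ)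
    (fun u hu => (hderiv u hu).differentiableAt.differentiableWithinAt)
    (fun u hu => (hderiv u hu).hasFDerivWithinAt.fderivWithin
      (Metric.isOpen_ball.uniqueDiffWithinAt hu)) hs (Metric.mem_ball_self hδ)

lemma eq_of_hasMFDerivAt_zero {γ : ℝ → M}
    (hγ : ∀ t, HasMFDerivAt 𝓘(ℝ, ℝ) I γ t (0 : ℝ →L[ℝ] E)) (s t : ℝ) : γ s = γ t :=
  IsLocallyConstant.apply_eq_of_preconnectedSpace
    ((IsLocallyConstant.iff_eventually_eq γ).2 (eventually_eq_of_hasMFDerivAt_zero hγ)) s t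

end ConstantCurve

section Flow

variable {E H N : Type*} [NormedAddCommGroup E] [NormedSpace ℝ E] [TopologicalSpace H]
  {I : ModelWithCorners ℝ E H} [TopologicalSpace N] [ChartedSpace H N] [AddAction ℝ N]

variable (I) in
/-- The smooth `k`-forms on `N` whose support meets each orbit in a compact set of times, locally
uniformly in the initial point. When the action is proper, these include the compactly supported
forms, and they are all that is needed for the integrals along the orbits. -/
def orbitwiseCompactForms (N : Type*) [TopologicalSpace N] [ChartedSpace H N] [AddAction ℝ N]
    (k : ℕ) : Submodule ℝ (N → E [⋀^Fin k]→L[ℝ] ℝ) where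
  carrier := {α | α ∈ smoothForms I N k ∧
    HasFiberwiseCompactSupport fun z : ℝ × N => α (z.1 +ᵥ z.2)}
  zero_mem' := ⟨Submodule.zero_mem _, .zero⟩
  add_mem' h h' := ⟨Submodule.add_mem _ h.1 h'.1, h.2.add h'.2⟩
  smul_mem' c α h := ⟨Submodule.smul_mem _ c h.1, h.2.mono fun z hz => by simp [hz]⟩

lemma compactForms_le_orbitwiseCompactForms [ProperVAdd ℝ N] (k : ℕ) :
    compactForms I N k ≤ orbitwiseCompactForms I N k :=
  fun _ hα => ⟨hα.1, hasFiberwiseCompactSupport_vadd hα.2⟩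

variable [ContMDiffVAdd 𝓘(ℝ, ℝ) I ∞ ℝ N]

lemma contMDiff_flowMap : ContMDiff (𝓘(ℝ, ℝ).prod I) I ∞ (flowMap N) := contMDiff_vadd

lemma hasMFDerivAt_flowMap (z : ℝ × N) : HasMFDerivAt (𝓘(ℝ, ℝ).prod I) I (flowMap N) z
    (modelDeriv (E := ℝ × E) (E' := E) (𝓘(ℝ, ℝ).prod I) I (flowMap N) z) :=
  (contMDiff_flowMap.mdifferentiable (by simp) z).hasMFDerivAt

lemma hasMFDerivAt_vadd_left (s : ℝ) (p : N) : HasMFDerivAt I I (fun q : N => s +ᵥ q) p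
    ((modelDeriv (E := ℝ × E) (E' := E) (𝓘(ℝ, ℝ).prod I) I (flowMap N) (s, p)).comp
      (ContinuousLinearMap.inr ℝ ℝ E)) := by
  have hslice : HasMFDerivAt I (𝓘(ℝ, ℝ).prod I) (fun q : N => (s, q)) p
      (ContinuousLinearMap.inr ℝ ℝ E) :=
    (hasMFDerivAt_const s p).prodMk (hasMFDerivAt_id p)
  exact (hasMFDerivAt_flowMap (s, p)).comp p hslice

lemma hasMFDerivAt_vadd_right (s : ℝ) (p : N) : HasMFDerivAt 𝓘(ℝ, ℝ) I (fun t : ℝ => t +ᵥ p) s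
    ((modelDeriv (E := ℝ × E) (E' := E) (𝓘(ℝ, ℝ).prod I) I (flowMap N) (s, p)).comp
      (ContinuousLinearMap.inl ℝ ℝ E)) := by
  have hslice : HasMFDerivAt 𝓘(ℝ, ℝ) (𝓘(ℝ, ℝ).prod I) (fun t : ℝ => (t, p)) s
      (ContinuousLinearMap.inl ℝ ℝ E) :=
    (hasMFDerivAt_id s).prodMk (hasMFDerivAt_const p s)
  exact (hasMFDerivAt_flowMap (s, p)).comp s hslice

lemma modelDeriv_flowMap_time (s : ℝ) (p : N) :
    modelDeriv (𝓘(ℝ, ℝ).prod I) I (flowMap N) (s, p) (1, 0) = flowField I (s +ᵥ p) := by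
  have hshift : HasMFDerivAt 𝓘(ℝ, ℝ) 𝓘(ℝ, ℝ) (fun t : ℝ => t + s) 0
      (ContinuousLinearMap.id ℝ ℝ) :=
    ((hasFDerivAt_id (𝕜 := ℝ) (0 : ℝ)).add_const s).hasMFDerivAt
  have horbit : HasMFDerivAt 𝓘(ℝ, ℝ) I (fun t : ℝ => t +ᵥ p) (0 + s) _ :=
    hasMFDerivAt_vadd_right (I := I) (0 + s) p
  have hcomp := horbit.comp (0 : ℝ) hshift
  have hassoc : (fun t : ℝ => t +ᵥ p) ∘ (fun t : ℝ => t + s) = fun t : ℝ => t +ᵥ (s +ᵥ p) :=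
    funext fun t => add_vadd t s p
  rw [hassoc] at hcomp
  have hvelocity := DFunLike.congr_fun hcomp.mfderiv (1 : ℝ)
  simp only [zero_add] at hvelocity
  exact hvelocity.symm

lemma modelDeriv_flowMap_flowField (s : ℝ) (p : N) :
    modelDeriv (𝓘(ℝ, ℝ).prod I) I (flowMap N) (s, p) (0, flowField I p) =
      flowField I (s +ᵥ p) := by
  have hleft : HasMFDerivAt I I (fun q : N => s +ᵥ q) ((0 : ℝ) +ᵥ p) _ :=
    hasMFDerivAt_vadd_left (I := I) s ((0 : ℝ) +ᵥ p)
  have hcomp := hleft.comp (0 : ℝ) (hasMFDerivAt_vadd_right (I := I) 0 p)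
  have hcomm : (fun q : N => s +ᵥ q) ∘ (fun t : ℝ => t +ᵥ p) = fun t : ℝ => t +ᵥ (s +ᵥ p) :=
    funext fun t => vadd_comm s t p
  rw [hcomm] at hcomp
  have hvelocity : flowField I (s +ᵥ p) =
      modelDeriv (𝓘(ℝ, ℝ).prod I) I (flowMap N) (s, (0 : ℝ) +ᵥ p)
        (0, modelDeriv (𝓘(ℝ, ℝ).prod I) I (flowMap N) (0, p) (1, 0)) :=
    DFunLike.congr_fun hcomp.mfderiv (1 : ℝ)
  rw [modelDeriv_flowMap_time, zero_vadd] at hvelocity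
  exact hvelocity.symm

lemma flowField_ne_zero [IsManifold I 1 N] [ProperVAdd ℝ N] (p : N) : flowField I p ≠ 0 := by
  intro hzero
  have hderiv (s : ℝ) : HasMFDerivAt 𝓘(ℝ, ℝ) I (fun t : ℝ => t +ᵥ p) s (0 : ℝ →L[ℝ] E) := by
    have hvelocity : modelDeriv (𝓘(ℝ, ℝ).prod I) I (flowMap N) (s, p) (1, 0) = (0 : E) := by
      rw [modelDeriv_flowMap_time, ← modelDeriv_flowMap_flowField, hzero, Prod.mk_zero_zero,
        map_zero]
    refine (congrArg (HasMFDerivAt 𝓘(ℝ, ℝ) I (fun t : ℝ => t +ᵥ p) s) ?_).mp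
      (hasMFDerivAt_vadd_right (I := I) s p)
    exact ContinuousLinearMap.ext_ring hvelocity
  have hfixed := eq_of_hasMFDerivAt_zero hderiv 1 0
  rw [zero_vadd] at hfixed
  exact one_ne_zero (eq_zero_of_vadd_eq_self hfixed)

lemma prIntegrand_flowPullback {k : ℕ} (α : N → E [⋀^Fin (k + 1)]→L[ℝ] ℝ) (p : N) (s : ℝ) :
    prIntegrand (flowPullback I α) p s =
      ((α (s +ᵥ p)).curryLeft (flowField I (s +ᵥ p))).compContinuousLinearMap
        ((modelDeriv (𝓘(ℝ, ℝ).prod I) I (flowMap N) (s, p)).comp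
          (ContinuousLinearMap.inr ℝ ℝ E)) := by
  rw [← modelDeriv_flowMap_time]
  ext v
  refine congrArg (α (s +ᵥ p)) (funext fun i => ?_)
  refine Fin.cases ?_ (fun j => ?_) i <;> rfl

variable [IsManifold I ∞ N] {k : ℕ}

lemma flowPullback_mem_fiberwiseCompactForms {α : N → E [⋀^Fin k]→L[ℝ] ℝ}
    (hα : α ∈ orbitwiseCompactForms I N k) : flowPullback I α ∈ fiberwiseCompactForms I N k :=
  ⟨formPullback_mem_smoothForms contMDiff_flowMap hα.1, hα.2.mono fun z hz => by
    rw [flowPullback, formPullback, flowMap, hz]; rfl⟩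

/-- The pullback `Θ^*` as a linear map. -/
def flowPullbackLinearMap :
    orbitwiseCompactForms I N k →ₗ[ℝ] fiberwiseCompactForms I N k where
  toFun α := ⟨flowPullback I α.1, flowPullback_mem_fiberwiseCompactForms α.2⟩
  map_add' α α' := Subtype.ext (formPullback_add α.1 α'.1)
  map_smul' c α := Subtype.ext (formPullback_smul c α.1)

/-- The operator `G^↑_Θ` as a linear map. -/
def greenForwardLinearMap : orbitwiseCompactForms I N (k + 1) →ₗ[ℝ] smoothForms I N k :=
  prIntegralLinearMap (Iic 0) ∘ₗ flowPullbackLinearMap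

set_option maxSynthPendingDepth 3 in
/-- The operator `G^↓_Θ` as a linear map. -/
def greenBackwardLinearMap : orbitwiseCompactForms I N (k + 1) →ₗ[ℝ] smoothForms I N k :=
  -(prIntegralLinearMap (Ici 0) ∘ₗ flowPullbackLinearMap)

lemma integrable_prIntegrand_flowPullback {α : N → E [⋀^Fin (k + 1)]→L[ℝ] ℝ}
    (hα : α ∈ orbitwiseCompactForms I N (k + 1)) (p : N) :
    Integrable (prIntegrand (flowPullback I α) p) :=
  integrable_prIntegrand (flowPullback_mem_fiberwiseCompactForms hα) p

lemma greenForward_sub_greenBackward {α : N → E [⋀^Fin (k + 1)]→L[ℝ] ℝ}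
    (hα : α ∈ orbitwiseCompactForms I N (k + 1)) :
    greenForward I α - greenBackward I α = prIntegral univ (flowPullback I α) := by
  rw [prIntegral_univ (flowPullback_mem_fiberwiseCompactForms hα), greenForward, greenBackward,
    sub_neg_eq_add]

end Flow

section LocalLift

lemma comp_eq_id_of_hasFDerivWithinAt {𝕜 E F : Type*} [NontriviallyNormedField 𝕜]
    [NormedAddCommGroup E] [NormedSpace 𝕜 E] [NormedAddCommGroup F] [NormedSpace 𝕜 F]
    {f : E → F} {g : F → E} {s : Set E} {t : Set F} {y : F} {D : E →L[𝕜] F} {L : F →L[𝕜] E}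
    (hf : HasFDerivWithinAt f D s (g y))
    (hLD : L.comp D = ContinuousLinearMap.id 𝕜 E) (hg : ContinuousWithinAt g t y)
    (hgs : MapsTo g t s) (hfg : ∀ᶠ z in 𝓝[t] y, f (g z) = z) (hy : y ∈ t)
    (ht : UniqueDiffWithinAt 𝕜 t y) : D.comp L = ContinuousLinearMap.id 𝕜 F := by
  have hfgy : f (g y) = y := hfg.self_of_nhdsWithin hy
  have htendsto : Filter.Tendsto g (𝓝[t] y) (𝓝[s] (g y)) :=
    hg.tendsto_nhdsWithin hgs
  have hexpand : (fun z => z - y - D (g z - g y)) =o[𝓝[t] y] fun z => g z - g y := by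
    refine (hf.isLittleO.comp_tendsto htendsto).congr' ?_ .rfl
    filter_upwards [hfg] with z hz
    simp only [Function.comp_apply, hz, hfgy]
  have hremainder : (fun z => g z - g y - L (z - y)) =o[𝓝[t] y] fun z => g z - g y := by
    refine ((L.isBigO_comp _ _).trans_isLittleO hexpand).neg_left.congr_left fun z => ?_
    have hLDz : L (D (g z - g y)) = g z - g y := DFunLike.congr_fun hLD (g z - g y)
    rw [map_sub L, hLDz, neg_sub]
  have hlipschitz : (fun z => g z - g y) =O[𝓝[t] y] fun z => z - y := by
    refine hremainder.right_isBigO_sub.trans ?_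
    simpa only [sub_sub_cancel] using L.isBigO_sub (𝓝[t] y) y
  have hderiv : HasFDerivWithinAt g L t y :=
    .of_isLittleO (hremainder.trans_isBigO hlipschitz)
  exact ht.eq ((hf.comp y hderiv hgs).congr_of_eventuallyEq
    (hfg.mono fun z hz => hz.symm) hfgy.symm) (hasFDerivWithinAt_id y t)

variable {𝕜 E H M : Type*} [NontriviallyNormedField 𝕜]
  [NormedAddCommGroup E] [NormedSpace 𝕜 E] [TopologicalSpace H]
  {I : ModelWithCorners 𝕜 E H} [TopologicalSpace M] [ChartedSpace H M]
  {E' H' M' : Type*} [NormedAddCommGroup E'] [NormedSpace 𝕜 E'] [TopologicalSpace H']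
  {I' : ModelWithCorners 𝕜 E' H'} [TopologicalSpace M'] [ChartedSpace H' M']

lemma comp_eq_id_of_hasMFDerivAt {f : M → M'} {g : M' → M} {y : M'}
    {D : E →L[𝕜] E'} {L : E' →L[𝕜] E} (hf : HasMFDerivAt I I' f (g y) D)
    (hLD : L.comp D = ContinuousLinearMap.id 𝕜 E) (hg : ContinuousAt g y)
    (hfg : ∀ᶠ z in 𝓝 y, f (g z) = z) : D.comp L = ContinuousLinearMap.id 𝕜 E' := by
  have hfgy : f (g y) = y := hfg.self_of_nhds
  have hy : (extChartAt I' y).symm (extChartAt I' y y) = y := extChartAt_to_inv y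
  have hsymm : Filter.Tendsto (extChartAt I' y).symm (𝓝[range I'] (extChartAt I' y y)) (𝓝 y) := by
    have hcont := (continuousAt_extChartAt_symm (I := I') y).tendsto
    rw [hy] at hcont
    exact hcont.mono_left nhdsWithin_le_nhds
  set f' : E → E' := extChartAt I' y ∘ f ∘ (extChartAt I (g y)).symm
  set g' : E' → E := extChartAt I (g y) ∘ g ∘ (extChartAt I' y).symm
  have hg'y : g' (extChartAt I' y y) = extChartAt I (g y) (g y) := by
    simp only [g', Function.comp_apply, hy]
  have hf' : HasFDerivWithinAt f' D (range I) (g' (extChartAt I' y y)) := by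
    have hchart := hf.2
    rw [writtenInExtChartAt, hfgy] at hchart
    rw [hg'y]
    exact hchart
  refine comp_eq_id_of_hasFDerivWithinAt (t := range I') hf' hLD ?_ (fun z _ => mem_range_self _) ?_
    (mem_range_self _) (I'.uniqueDiffOn _ (mem_range_self _))
  · rw [ContinuousWithinAt, hg'y]
    exact (continuousAt_extChartAt (g y)).tendsto.comp (hg.tendsto.comp hsymm)
  · filter_upwards [hsymm.eventually hfg, extChartAt_target_mem_nhdsWithin (I := I') y,
      (hg.tendsto.comp hsymm).eventually (extChartAt_source_mem_nhds (I := I) (g y))]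
      with z hfgz hz hgz
    rw [Function.comp_apply] at hgz
    simp only [f', g', Function.comp_apply, (extChartAt I (g y)).left_inv hgz, hfgz,
      (extChartAt I' y).right_inv hz]

end LocalLift

section Contraction

variable {𝕜 E F : Type*} [NontriviallyNormedField 𝕜] [NormedAddCommGroup E] [NormedSpace 𝕜 E]
  [NormedAddCommGroup F] [NormedSpace 𝕜 F] {k : ℕ}

lemma curryLeft_eq_of_eq_add_smul (f : E [⋀^Fin (k + 1)]→L[𝕜] F) (X : E) {u w : Fin k → E}
    (h : ∀ i, ∃ c : 𝕜, u i = w i + c • X) : f.curryLeft X u = f.curryLeft X w := by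
  classical
  have hpiecewise (t : Finset (Fin k)) : f.curryLeft X (t.piecewise u w) = f.curryLeft X w := by
    induction t using Finset.induction_on with
    | empty => rw [Finset.piecewise_empty]
    | insert i t hi ih =>
      obtain ⟨c, hc⟩ := h i
      have hX : f.curryLeft X (Function.update (t.piecewise u w) i X) = 0 :=
        f.map_eq_zero_of_eq _ (i := 0) (j := i.succ) (by simp) (Fin.succ_ne_zero i).symm
      rw [Finset.piecewise_insert, hc, ContinuousAlternatingMap.map_update_add,
        ContinuousAlternatingMap.map_update_smul, hX, smul_zero, add_zero,
        ← Finset.piecewise_eq_of_notMem t u w hi, Function.update_eq_self, ih]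
  simpa only [Finset.piecewise_univ] using hpiecewise Finset.univ

end Contraction

section Quotient

lemma exists_continuousAt_time_to_section {N : Type*} [TopologicalSpace N] [AddAction ℝ N]
    [ProperVAdd ℝ N] {p : N} {σ : AddAction.orbitRel.Quotient ℝ N → N}
    (hσ : ContinuousAt σ (orbitMap N p)) (hsection : ∀ᶠ c in 𝓝 (orbitMap N p),
      orbitMap N (σ c) = c) :
    ∃ τ : N → ℝ, ContinuousAt τ p ∧ ∀ᶠ q in 𝓝 p, τ q +ᵥ σ (orbitMap N q) = q := by
  have horbit : ContinuousAt (orbitMap N) p := continuous_quotient_mk'.continuousAt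
  have hlift : ∀ q, ∃ t : ℝ, orbitMap N (σ (orbitMap N q)) = orbitMap N q →
      t +ᵥ σ (orbitMap N q) = q := fun q => by
    by_cases hq : orbitMap N (σ (orbitMap N q)) = orbitMap N q
    · obtain ⟨t, ht⟩ := orbitMap_eq_iff.1 hq.symm
      exact ⟨t, fun _ => ht⟩
    · exact ⟨0, fun h => absurd h hq⟩
  choose τ hτ using hlift
  have hτ' : ∀ᶠ q in 𝓝 p, τ q +ᵥ σ (orbitMap N q) = q :=
    (horbit.eventually hsection).mono hτ
  have hpair : ContinuousAt (fun q => (τ q, σ (orbitMap N q))) p := by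
    rw [(isClosedEmbedding_vadd_pair (N := N)).isInducing.continuousAt_iff]
    refine (continuousAt_id.prodMk (hσ.comp horbit)).congr ?_
    filter_upwards [hτ'] with q hq
    exact Prod.ext hq.symm rfl
  exact ⟨τ, hpair.fst, hτ'⟩

variable {E H N : Type*} [NormedAddCommGroup E] [NormedSpace ℝ E] [TopologicalSpace H]
  {I : ModelWithCorners ℝ E H} [TopologicalSpace N] [ChartedSpace H N] [AddAction ℝ N]
  {E' H' : Type*} [NormedAddCommGroup E'] [NormedSpace ℝ E'] [TopologicalSpace H']
  {I' : ModelWithCorners ℝ E' H'} [ChartedSpace H' (AddAction.orbitRel.Quotient ℝ N)]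

lemma fiberIntegral_orbitMap {k : ℕ} (α : N → E [⋀^Fin (k + 1)]→L[ℝ] ℝ) (p : N) :
    fiberIntegral I I' α (orbitMap N p) = ∫ s : ℝ, orbitIntegrand I I' α (s +ᵥ p) := by
  obtain ⟨t, ht⟩ := orbitMap_eq_iff.1 (Quotient.out_eq (orbitMap N p))
  rw [fiberIntegral, ← ht]
  simp_rw [vadd_vadd]
  exact integral_add_right_eq_self (fun s : ℝ => orbitIntegrand I I' α (s +ᵥ p)) t

namespace IsQuotientManifold

lemma hasMFDerivAt_orbitMap (hquot : IsQuotientManifold (N := N) I I') (p : N) :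
    HasMFDerivAt I I' (orbitMap N) p (modelDeriv (E := E) (E' := E') I I' (orbitMap N) p) :=
  (hquot.contMDiff_orbitMap.mdifferentiable (by simp) p).hasMFDerivAt

variable [ContMDiffVAdd 𝓘(ℝ, ℝ) I ∞ ℝ N]

lemma modelDeriv_orbitMap_flowMap (hquot : IsQuotientManifold (N := N) I I') (s : ℝ) (p : N)
    (v : E) : modelDeriv I I' (orbitMap N) (s +ᵥ p)
      (modelDeriv (𝓘(ℝ, ℝ).prod I) I (flowMap N) (s, p) (0, v)) =
        modelDeriv I I' (orbitMap N) p v := by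
  have hcomp := (hquot.hasMFDerivAt_orbitMap (s +ᵥ p)).comp p
    (hasMFDerivAt_vadd_left (I := I) s p)
  have hinvariant : orbitMap N ∘ (fun q : N => s +ᵥ q) = orbitMap N :=
    funext fun q => orbitMap_vadd s q
  rw [hinvariant] at hcomp
  exact (DFunLike.congr_fun hcomp.mfderiv v).symm

lemma exists_local_trivialization [ProperVAdd ℝ N] (hquot : IsQuotientManifold (N := N) I I')
    (p : N) : ∃ (F : ℝ × AddAction.orbitRel.Quotient ℝ N → N) (τ : N → ℝ) (D : ℝ × E' →L[ℝ] E),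
      HasMFDerivAt (𝓘(ℝ, ℝ).prod I') I F (τ p, orbitMap N p) D ∧ ContinuousAt τ p ∧
      (∀ᶠ q in 𝓝 p, F (τ q, orbitMap N q) = q) ∧ D (1, 0) = flowField I p ∧
      (modelDeriv I I' (orbitMap N) p).comp D = ContinuousLinearMap.snd ℝ ℝ E' := by
  obtain ⟨U, hU, σ, hσ, hsection⟩ := hquot.exists_local_section (orbitMap N p)
  have hσp : ContMDiffAt I' I ∞ σ (orbitMap N p) := (hσ _ (mem_of_mem_nhds hU)).contMDiffAt hU
  obtain ⟨τ, hτ, hτσ⟩ := exists_continuousAt_time_to_section hσp.continuousAt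
    (Filter.mem_of_superset hU hsection)
  have hp : τ p +ᵥ σ (orbitMap N p) = p := hτσ.self_of_nhds
  have hshear : HasMFDerivAt (𝓘(ℝ, ℝ).prod I') (𝓘(ℝ, ℝ).prod I)
      (fun z : ℝ × AddAction.orbitRel.Quotient ℝ N => (z.1, σ z.2)) (τ p, orbitMap N p)
      ((ContinuousLinearMap.fst ℝ ℝ E').prod ((modelDeriv (E := E') (E' := E) I' I σ
        (orbitMap N p)).comp (ContinuousLinearMap.snd ℝ ℝ E'))) :=
    (hasMFDerivAt_fst _).prodMk
      (((hσp.mdifferentiableAt (by simp)).hasMFDerivAt).comp (τ p, orbitMap N p)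
        (hasMFDerivAt_snd _))
  have hF := (hasMFDerivAt_flowMap (I := I) (τ p, σ (orbitMap N p))).comp
    (τ p, orbitMap N p) hshear
  refine ⟨_, τ, _, hF, hτ, hτσ, ?_, ?_⟩
  · have htime := modelDeriv_flowMap_time (I := I) (τ p) (σ (orbitMap N p))
    rw [hp, ← map_zero (modelDeriv (E := E') (E' := E) I' I σ (orbitMap N p))] at htime
    exact htime
  · have hπ : HasMFDerivAt I I' (orbitMap N) (τ p +ᵥ σ (orbitMap N p)) _ :=
      hquot.hasMFDerivAt_orbitMap _
    have hπF := hπ.comp (τ p, orbitMap N p) hF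
    have hsnd : Prod.snd =ᶠ[𝓝 (τ p, orbitMap N p)] orbitMap N ∘ flowMap N ∘
        fun z : ℝ × AddAction.orbitRel.Quotient ℝ N => (z.1, σ z.2) := by
      filter_upwards [continuousAt_snd.preimage_mem_nhds hU] with z hz
      exact (hsection z.2 hz).symm.trans (orbitMap_vadd z.1 (σ z.2)).symm
    rw [hp] at hπF
    exact hasMFDerivAt_unique (hπF.congr_of_eventuallyEq hsnd) (hasMFDerivAt_snd _)

variable [ProperVAdd ℝ N]

lemma exists_rightInverse (hquot : IsQuotientManifold (N := N) I I') (p : N) :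
    ∃ R : E' →L[ℝ] E, ∀ v, modelDeriv I I' (orbitMap N) p (R v) = v := by
  obtain ⟨-, -, D, -, -, -, -, hπD⟩ := hquot.exists_local_trivialization p
  exact ⟨D.comp (.inr ℝ ℝ E'), fun v => DFunLike.congr_fun hπD (0, v)⟩

lemma modelDeriv_tangentLift (hquot : IsQuotientManifold (N := N) I I') (p : N) (v : E') :
    modelDeriv I I' (orbitMap N) p (tangentLift I I' p v) = v :=
  Classical.epsilon_spec (hquot.exists_rightInverse p) v

/-- The local trivialization `F` has a continuous inverse, and its differential `D` has a left
inverse, built from `dπ` and a functional that is `1` on `X`. Hence that left inverse is also a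
right inverse. -/
lemma exists_eq_smul_flowField [IsManifold I 1 N]
    (hquot : IsQuotientManifold (N := N) I I') {p : N} {v : E}
    (hv : modelDeriv I I' (orbitMap N) p v = 0) : ∃ c : ℝ, v = c • flowField I p := by
  obtain ⟨F, τ, D, hF, hτ, hFτ, hD, hπD⟩ := hquot.exists_local_trivialization p
  obtain ⟨ℓ, hℓ⟩ := SeparatingDual.exists_eq_one (R := ℝ) (flowField_ne_zero (I := I) p)
  have hsplit (c : ℝ) (w : E') : D (c, w) = c • flowField I p + D (0, w) := by
    rw [← hD, ← map_smul, ← map_add, Prod.smul_mk, Prod.mk_add_mk]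
    simp
  set π' := modelDeriv I I' (orbitMap N) p
  have hπD' (z : ℝ × E') : π' (D z) = z.2 := DFunLike.congr_fun hπD z
  let L : E →L[ℝ] ℝ × E' :=
    (ℓ.comp (.id ℝ E - (D.comp (.inr ℝ ℝ E')).comp π')).prod π'
  have hL (u : E) : L u = (ℓ (u - D (0, π' u)), π' u) := rfl
  have hLD : L.comp D = .id ℝ (ℝ × E') := by
    refine ContinuousLinearMap.ext fun ⟨c, w⟩ => ?_
    rw [ContinuousLinearMap.comp_apply, hL, hπD', hsplit, add_sub_cancel_right, map_smul, hℓ,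
      smul_eq_mul, mul_one, ContinuousLinearMap.id_apply]
  have hDL : D.comp L = .id ℝ E :=
    comp_eq_id_of_hasMFDerivAt hF hLD
      (hτ.prodMk hquot.contMDiff_orbitMap.continuous.continuousAt) hFτ
  refine ⟨ℓ v, ?_⟩
  calc v = D (L v) := (DFunLike.congr_fun hDL v).symm
    _ = ℓ v • flowField I p := by
      rw [hL, hv, Prod.mk_zero_zero, map_zero, sub_zero, hsplit, Prod.mk_zero_zero, map_zero,
        add_zero]

lemma orbitIntegrand_comp_modelDeriv [IsManifold I 1 N]
    (hquot : IsQuotientManifold (N := N) I I') {k : ℕ}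
    (α : N → E [⋀^Fin (k + 1)]→L[ℝ] ℝ) (p : N) (s : ℝ) :
    (orbitIntegrand I I' α (s +ᵥ p)).compContinuousLinearMap (modelDeriv I I' (orbitMap N) p) =
      prIntegrand (flowPullback I α) p s := by
  rw [prIntegrand_flowPullback]
  ext v
  refine curryLeft_eq_of_eq_add_smul (α (s +ᵥ p)) _ fun i => ?_
  have hker : modelDeriv I I' (orbitMap N) (s +ᵥ p)
      (tangentLift I I' (s +ᵥ p) (modelDeriv I I' (orbitMap N) p (v i)) -
        modelDeriv (𝓘(ℝ, ℝ).prod I) I (flowMap N) (s, p) (0, v i)) = 0 := by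
    rw [map_sub, hquot.modelDeriv_tangentLift, hquot.modelDeriv_orbitMap_flowMap, sub_self]
  obtain ⟨c, hc⟩ := hquot.exists_eq_smul_flowField hker
  exact ⟨c, eq_add_of_sub_eq' hc⟩

variable [IsManifold I ∞ N] {k : ℕ} {α : N → E [⋀^Fin (k + 1)]→L[ℝ] ℝ}

lemma integrable_orbitIntegrand (hquot : IsQuotientManifold (N := N) I I')
    (hα : α ∈ orbitwiseCompactForms I N (k + 1)) (p : N) :
    Integrable fun s : ℝ => orbitIntegrand I I' α (s +ᵥ p) := by
  obtain ⟨R, hR⟩ := hquot.exists_rightInverse p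
  have hpullback (s : ℝ) : orbitIntegrand I I' α (s +ᵥ p) =
      (prIntegrand (flowPullback I α) p s).compContinuousLinearMap R := by
    rw [← hquot.orbitIntegrand_comp_modelDeriv α p s]
    ext v
    simp only [ContinuousAlternatingMap.compContinuousLinearMap_apply, Function.comp_def, hR]
  simp_rw [hpullback]
  exact (ContinuousAlternatingMap.compContinuousLinearMapCLM (ι := Fin k) (F := ℝ)
    R).integrable_comp (integrable_prIntegrand_flowPullback hα p)

lemma formPullback_fiberIntegral (hquot : IsQuotientManifold (N := N) I I')
    (hα : α ∈ orbitwiseCompactForms I N (k + 1)) :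
    formPullback I I' (orbitMap N) (fiberIntegral I I' α) =
      prIntegral univ (flowPullback I α) := by
  funext p
  rw [formPullback, fiberIntegral_orbitMap, prIntegral, setIntegral_univ]
  simp_rw [← hquot.orbitIntegrand_comp_modelDeriv]
  exact ((ContinuousAlternatingMap.compContinuousLinearMapCLM (ι := Fin k) (F := ℝ)
    (modelDeriv I I' (orbitMap N) p)).integral_comp_comm
      (hquot.integrable_orbitIntegrand hα p)).symm

variable [IsManifold I' ∞ (AddAction.orbitRel.Quotient ℝ N)]

lemma fiberIntegral_mem_smoothForms (hquot : IsQuotientManifold (N := N) I I')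
    (hα : α ∈ orbitwiseCompactForms I N (k + 1)) :
    fiberIntegral I I' α ∈ smoothForms I' (AddAction.orbitRel.Quotient ℝ N) k := by
  refine mem_smoothForms_of_formPullback_mem hquot.contMDiff_orbitMap
    hquot.exists_local_section ?_
  rw [hquot.formPullback_fiberIntegral hα]
  exact prIntegral_mem_smoothForms (flowPullback_mem_fiberwiseCompactForms hα) univ

/-- Fiber integration `π_*` along the quotient map, as a linear map. -/
def fiberIntegralLinearMap (hquot : IsQuotientManifold (N := N) I I') (k : ℕ) :
    orbitwiseCompactForms I N (k + 1) →ₗ[ℝ]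
      smoothForms I' (AddAction.orbitRel.Quotient ℝ N) k where
  toFun α := ⟨fiberIntegral I I' α.1, hquot.fiberIntegral_mem_smoothForms α.2⟩
  map_add' α α' := Subtype.ext <| funext fun b => integral_add
    (hquot.integrable_orbitIntegrand α.2 b.out) (hquot.integrable_orbitIntegrand α'.2 b.out)
  map_smul' c α := Subtype.ext <| funext fun b =>
    integral_smul c fun s : ℝ => orbitIntegrand I I' α.1 (s +ᵥ b.out)

end IsQuotientManifold

end Quotient

end

theorem mainTheorem12_general
    {E H N : Type*} [NormedAddCommGroup E] [NormedSpace ℝ E]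
    [TopologicalSpace H] (I : ModelWithCorners ℝ E H)
    [TopologicalSpace N] [ChartedSpace H N] [IsManifold I ∞ N]
    [AddAction ℝ N] [ContMDiffVAdd 𝓘(ℝ, ℝ) I ∞ ℝ N] [ProperVAdd ℝ N]
    {E' H' : Type*} [NormedAddCommGroup E'] [NormedSpace ℝ E']
    [TopologicalSpace H'] (I' : ModelWithCorners ℝ E' H')
    [ChartedSpace H' (AddAction.orbitRel.Quotient ℝ N)]
    [IsManifold I' ∞ (AddAction.orbitRel.Quotient ℝ N)]
    (hquot : IsQuotientManifold (N := N) I I') :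
    (∀ (k : ℕ) (α : orbitwiseCompactForms I N (k + 1)) (p : N),
      IntegrableOn (prIntegrand (flowPullback I α.1) p) (Iic 0) ∧
      IntegrableOn (prIntegrand (flowPullback I α.1) p) (Ici 0) ∧
      Integrable (fun s : ℝ => orbitIntegrand I I' α.1 (s +ᵥ p))) ∧
    ∃ (Gup Gdown : ∀ k : ℕ, orbitwiseCompactForms I N (k + 1) →ₗ[ℝ] smoothForms I N k)
      (piPush : ∀ k : ℕ, orbitwiseCompactForms I N (k + 1) →ₗ[ℝ]
        smoothForms I' (AddAction.orbitRel.Quotient ℝ N) k)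
      (piPull : ∀ k : ℕ, smoothForms I' (AddAction.orbitRel.Quotient ℝ N) k →ₗ[ℝ]
        smoothForms I N k),
      (∀ k α, (Gup k α).1 = greenForward I α.1) ∧
      (∀ k α, (Gdown k α).1 = greenBackward I α.1) ∧
      (∀ k α, (piPush k α).1 = fiberIntegral I I' α.1) ∧
      (∀ k β, (piPull k β).1 = formPullback I I' (orbitMap N) β.1) ∧
      ∀ k α, Gup k α - Gdown k α = piPull k (piPush k α) := by
  refine ⟨fun k α p => ?_, fun _ => greenForwardLinearMap, fun _ => greenBackwardLinearMap,
    hquot.fiberIntegralLinearMap, smoothFormsPullback hquot.contMDiff_orbitMap,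
    fun _ _ => rfl, fun _ _ => rfl, fun _ _ => rfl, fun _ _ => rfl, fun k α => Subtype.ext ?_⟩
  · have hflow := integrable_prIntegrand_flowPullback α.2 p
    exact ⟨hflow.integrableOn, hflow.integrableOn, hquot.integrable_orbitIntegrand α.2 p⟩
  · exact (greenForward_sub_greenBackward α.2).trans
      (hquot.formPullback_fiberIntegral α.2).symm

theorem mainTheorem12
    {E H N : Type*} [NormedAddCommGroup E] [NormedSpace ℝ E] [FiniteDimensional ℝ E]
    [TopologicalSpace H] (I : ModelWithCorners ℝ E H)
    [TopologicalSpace N] [T2Space N] [SecondCountableTopology N]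
    [ChartedSpace H N] [IsManifold I ∞ N]
    [AddAction ℝ N] [ContMDiffVAdd 𝓘(ℝ, ℝ) I ∞ ℝ N] [ProperVAdd ℝ N]
    {E' H' : Type*} [NormedAddCommGroup E'] [NormedSpace ℝ E'] [FiniteDimensional ℝ E']
    [TopologicalSpace H'] (I' : ModelWithCorners ℝ E' H')
    [ChartedSpace H' (AddAction.orbitRel.Quotient ℝ N)]
    [IsManifold I' ∞ (AddAction.orbitRel.Quotient ℝ N)]
    (hquot : IsQuotientManifold (N := N) I I') :
    -- all the integrals converge
    (∀ (k : ℕ) (α : compactForms I N (k + 1)) (p : N),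
      IntegrableOn (prIntegrand (flowPullback I α.1) p) (Iic 0) ∧
      IntegrableOn (prIntegrand (flowPullback I α.1) p) (Ici 0) ∧
      Integrable (fun s : ℝ => orbitIntegrand I I' α.1 (s +ᵥ p))) ∧
    -- the formulas define linear maps between spaces of smooth forms, and these satisfy
    -- `G^↑ - G^↓ = π^* ∘ π_*`
    ∃ (Gup Gdown : ∀ k : ℕ, compactForms I N (k + 1) →ₗ[ℝ] smoothForms I N k)
      (piPush : ∀ k : ℕ, compactForms I N (k + 1) →ₗ[ℝ]
        smoothForms I' (AddAction.orbitRel.Quotient ℝ N) k)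
      (piPull : ∀ k : ℕ, smoothForms I' (AddAction.orbitRel.Quotient ℝ N) k →ₗ[ℝ]
        smoothForms I N k),
      (∀ k α, (Gup k α).1 = greenForward I α.1) ∧
      (∀ k α, (Gdown k α).1 = greenBackward I α.1) ∧
      (∀ k α, (piPush k α).1 = fiberIntegral I I' α.1) ∧
      (∀ k β, (piPull k β).1 = formPullback I I' (orbitMap N) β.1) ∧
      ∀ k α, Gup k α - Gdown k α = piPull k (piPush k α) := by
  obtain ⟨hint, Gup, Gdown, piPush, piPull, hup, hdown, hpush, hpull, hdiff⟩ :=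
    mainTheorem12_general I I' hquot
  let ι (k : ℕ) := Submodule.inclusion (compactForms_le_orbitwiseCompactForms (I := I) (N := N) k)
  exact ⟨fun k α => hint k (ι _ α), fun k => Gup k ∘ₗ ι _, fun k => Gdown k ∘ₗ ι _,
    fun k => piPush k ∘ₗ ι _, piPull, fun k α => hup k (ι _ α), fun k α => hdown k (ι _ α),
    fun k α => hpush k (ι _ α), hpull, fun k α => hdiff k (ι _ α)⟩
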